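/- Let $0<r<R$, $\rho\in(0,2)$, $\kappa>1$, $N\in\{0,1,2,\ldots\}$, $M=\lfloor\kappa N\rfloor$, and $\sigma_n=(r/R)^{n+1}$. Let $\{Y_{n,k}\}_{n\ge 0,\,1\le k\le 2n+1}$ be a set of spherical harmonics ($n$ the degree) orthonormal in $L^2$ of the unit sphere of $\mathbb{R}^3$, and for unit vectors $\xi$ put $$y^{(1)}_{n,k}(\xi)=\xi\,Y_{n,k}(\xi)\ (n\ge 0),\qquad y^{(2)}_{n,k}(\xi)=\tfrac{1}{\sqrt{n(n+1)}}\nabla^*_\xi Y_{n,k}(\xi)\ (n\ge 1),$$ where $\nabla^*$ is the surface gradient, i.e. the tangential part of the gradient. Put $0_1=0$, $0_2=1$, and $x\otimes y=xy^T$. For $a,b>0$ and $L\ge 0$ let $\mathbf{Pol}_L(a,b)$ be the space of the tensorial kernels $$\mathbf{K}(x,y)=\sum_{i=1}^{2}\sum_{n=0_i}^{L}\sum_{k=1}^{2n+1}\mathbf{K}^\wedge(n)\,\tfrac1a\,y^{(i)}_{n,k}\big(\tfrac{x}{|x|}\big)\otimes\tfrac1b\,y^{(i)}_{n,k}\big(\tfrac{y}{|y|}\big),\qquad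 |x|=a,\ |y|=b,$$ with real symbols $\mathbf{K}^\wedge(n)$, $n=0,\ldots,L$ (and $\mathbf{K}^\wedge(n)=0$ for $n>L$). For such a kernel with $a=b$, the Frobenius norm $|\mathbf{K}(x,y)|$ depends only on $t=\frac{x}{|x|}\cdot\frac{y}{|y|}$; write $|\mathbf{K}|(t)$ for it and $\|\mathbf{K}\|_{L^2([-1,1-\rho])}=\big(\int_{-1}^{1-\rho}|\mathbf{K}|(t)^2\,dt\big)^{1/2}$. Let $\alpha_{N,n}$ ($0\le n\le N$), $\tilde\alpha_{N,n}$ ($0\le n\le M$) and $\beta_N$ be positive. For $\mathbf{\Phi}\in\mathbf{Pol}_N(r,R)$ and $\tilde{\mathbf{\Psi}}\in\mathbf{Pol}_M(r,r)$ put $\tilde{\mathbf{\Phi}}^\wedge(n)=\tilde{\mathbf{\Psi}}^\wedge(n)+\mathbf{\Phi}^\wedge(n)\sigma_n$ and $$\mathcal{F}(\mathbf{\Phi},\tilde{\mathbf{\Psi}})=\sum_{n=0}^{M}\tilde\alpha_{N,n}\big|1-\tilde{\mathbf{\Phi}}^\wedge(n)\big|^2+\sum_{n=0}^{N}\alpha_{N,n}\big|1-\mathbf{\Phi}^\wedge(n)\sigma_n\big|^2+\beta_N\sum_{n=0}^{N}\big|\mathbf{\Phi}^\wedge(n)\big|^2+8\pi^2r^4\big\|\tilde{\mathbf{\Psi}}\big\|^2_{L^2([-1,1-\rho])}.$$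 Then $\mathcal{F}$ has exactly one minimizer $(\mathbf{\Phi}_N,\tilde{\mathbf{\Psi}}_N)$ in $\mathbf{Pol}_N(r,R)\times\mathbf{Pol}_M(r,r)$. A pair in this space is the minimizer if and only if the vector $$\phi=\big(\mathbf{\Phi}_N^\wedge(0)\sigma_0,\ldots,\mathbf{\Phi}_N^\wedge(N)\sigma_N,\tilde{\mathbf{\Phi}}_N^\wedge(0),\ldots,\tilde{\mathbf{\Phi}}_N^\wedge(M)\big)^T$$ of the pair solves the linear system $\mathbf{M}\phi=\alpha$, and this system is uniquely solvable. Here $\alpha=(\alpha_{N,0},\ldots,\alpha_{N,N},\tilde\alpha_{N,0},\ldots,\tilde\alpha_{N,M})^T$, $$\mathbf{M}=\left(\begin{array}{c|c}\mathbf{D}_1+\mathbf{P}_1&-\mathbf{P}_2\\\hline-\mathbf{P}_3&\mathbf{D}_2+\mathbf{P}_4\end{array}\right),\quad \mathbf{D}_1=\mathrm{diag}\Big(\frac{\beta_N}{\sigma_n^2}+\alpha_{N,n}\Big)_{n=0,\ldots,N},\quad \mathbf{D}_2=\mathrm{diag}\big(\tilde\alpha_{N,n}\big)_{n=0,\ldots,M},$$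 $\mathbf{P}_1=(P^\rho_{n,m})_{n,m=0,\ldots,N}$, $\mathbf{P}_2=(P^\rho_{n,m})_{n=0,\ldots,N;\,m=0,\ldots,M}$, $\mathbf{P}_3=(P^\rho_{n,m})_{n=0,\ldots,M;\,m=0,\ldots,N}$, $\mathbf{P}_4=(P^\rho_{n,m})_{n,m=0,\ldots,M}$, where, with the Legendre polynomials $P_n$, for $n\ne0$ and $m\ne 0$ $$P^\rho_{n,m}=\frac{(2n+1)(2m+1)}{2}\int_{-1}^{1-\rho}P_nP_m\,dt+\frac{(2n+1)(2m+1)}{2n(n+1)m(m+1)}\bigg(\int_{-1}^{1-\rho}(1+t^2)P_n'P_m'\,dt+\int_{-1}^{1-\rho}(1-t^2)^2P_n''P_m''\,dt$$ $$\qquad-\int_{-1}^{1-\rho}t(1-t^2)P_n''P_m'\,dt-\int_{-1}^{1-\rho}t(1-t^2)P_n'P_m''\,dt\bigg),$$ and $P^\rho_{n,m}=\frac{(2n+1)(2m+1)}{2}\int_{-1}^{1-\rho}P_nP_m\,dt$ if $n=0$ or $m=0$. -/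

import Mathlib

noncomputable section

namespace TensorZonal

/-- Euclidean three-space. -/
abbrev E3 : Type := EuclideanSpace ℝ (Fin 3)

/-- The sphere of radius `a` about the origin. -/
abbrev Sph (a : ℝ) : Type := Metric.sphere (0 : E3) a

/-- Tensor kernels on (sphere of radius `a`) times (sphere of radius `b`). -/
abbrev Kernel (a b : ℝ) : Type := Sph a → Sph b → Matrix (Fin 3) (Fin 3) ℝ

/-- The function on three-space defined by a polynomial in the Cartesian coordinates. -/
def polyFun (p : MvPolynomial (Fin 3) ℝ) (x : E3) : ℝ :=
  MvPolynomial.eval (fun i => x i) p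

/-- `Y n k` (`k` running through `2 n + 1` indices) is a full set of spherical harmonics,
orthonormal in `L²` of the unit sphere with its surface measure (total mass `4 π`).
A spherical harmonic of degree `n` is given as a homogeneous harmonic polynomial of degree `n`;
only its values on the unit sphere matter. -/
structure IsSphericalHarmonics
    (Y : (n : ℕ) → Fin (2 * n + 1) → MvPolynomial (Fin 3) ℝ) : Prop where
  homogeneous : ∀ n k, (Y n k).IsHomogeneous n
  harmonic : ∀ n k, ∑ i : Fin 3, MvPolynomial.pderiv i (MvPolynomial.pderiv i (Y n k)) = 0
  orthonormal : ∀ n k m l,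
    ∫ ξ : Sph 1, polyFun (Y n k) (ξ : E3) * polyFun (Y m l) (ξ : E3)
        ∂(MeasureTheory.volume : MeasureTheory.Measure E3).toSphere
      = if (⟨n, k⟩ : (n : ℕ) × Fin (2 * n + 1)) = ⟨m, l⟩ then 1 else 0

/-- Surface gradient at a unit vector `ξ`: the tangential part of the gradient. -/
def surfaceGradient (F : E3 → ℝ) (ξ : E3) : E3 :=
  gradient F ξ - inner ℝ ξ (gradient F ξ) • ξ

/-- Vector spherical harmonics at a unit vector `ξ`. The index `0` is type 1 (`ξ Y(ξ)`), the
index `1` is type 2 (normalised surface gradient of `Y`). -/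
def vectorHarmonic (i : Fin 2) (n : ℕ) (p : MvPolynomial (Fin 3) ℝ) (ξ : E3) : E3 :=
  if i = 0 then polyFun p ξ • ξ
  else (1 / Real.sqrt ((n : ℝ) * ((n : ℝ) + 1))) • surfaceGradient (polyFun p) ξ

/-- The tensor product `v wᵀ`. -/
def tensor (v w : E3) : Matrix (Fin 3) (Fin 3) ℝ :=
  Matrix.vecMulVec (fun i => v i) (fun i => w i)

/-- The bandlimited tensorial kernel of maximal degree `N` with symbols `s n`,
`K(x,y) = ∑_i ∑_{n = 0_i}^N ∑_k s n (1/a) y_{n,k}^{(i)}(x/|x|) ⊗ (1/b) y_{n,k}^{(i)}(y/|y|)`,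
for `|x| = a`, `|y| = b`, where the lower summation index `0_i` is `0` for type 1, and `1` for
type 2. -/
def kernelOf (Y : (n : ℕ) → Fin (2 * n + 1) → MvPolynomial (Fin 3) ℝ) (a b : ℝ) (N : ℕ)
    (s : ℕ → ℝ) : Kernel a b := fun x y =>
  ∑ i : Fin 2, ∑ n ∈ Finset.Icc (i : ℕ) N, ∑ k : Fin (2 * n + 1),
    s n • tensor ((1 / a) • vectorHarmonic i n (Y n k) ((1 / ‖(x : E3)‖) • (x : E3)))
      ((1 / b) • vectorHarmonic i n (Y n k) ((1 / ‖(y : E3)‖) • (y : E3)))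

/-- The space of bandlimited tensorial kernels with maximal degree `N`. -/
def Pol (Y : (n : ℕ) → Fin (2 * n + 1) → MvPolynomial (Fin 3) ℝ) (a b : ℝ) (N : ℕ) :
    Set (Kernel a b) :=
  Set.range (kernelOf Y a b N)

/-- `s` is the sequence of symbols of the bandlimited kernel `K` of maximal degree `N`; symbols of
degree larger than `N` are zero. -/
def HasSymbol (Y : (n : ℕ) → Fin (2 * n + 1) → MvPolynomial (Fin 3) ℝ) (a b : ℝ) (N : ℕ)
    (K : Kernel a b) (s : ℕ → ℝ) : Prop :=
  (∀ n, N < n → s n = 0) ∧ K = kernelOf Y a b N s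

open Classical in
/-- The symbols `K^∧(n)` of a kernel in `Pol Y a b N`. -/
def symbol (Y : (n : ℕ) → Fin (2 * n + 1) → MvPolynomial (Fin 3) ℝ) (a b : ℝ) (N : ℕ)
    (K : Kernel a b) : ℕ → ℝ :=
  if h : ∃ s : ℕ → ℝ, HasSymbol Y a b N K s then Classical.choose h else 0

/-- Euclidean (Frobenius) absolute value of a tensor. -/
def tensorAbs (A : Matrix (Fin 3) (Fin 3) ℝ) : ℝ :=
  Real.sqrt (∑ i, ∑ j, A i j ^ 2)

/-- The absolute value `|K(x,y)|` of a tensor-zonal kernel on the sphere of radius `a` as a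
function of `t = (x/|x|) ⬝ (y/|y|)`. For a tensor-zonal kernel and `t` in `[-1,1]` the set below
has exactly one element, and the supremum picks it. -/
def profile {a : ℝ} (K : Kernel a a) (t : ℝ) : ℝ :=
  sSup {c : ℝ | ∃ x y : Sph a,
    inner ℝ ((1 / ‖(x : E3)‖) • (x : E3)) ((1 / ‖(y : E3)‖) • (y : E3)) = t ∧
      c = tensorAbs (K x y)}

/-- The one-dimensional norm `‖K‖` in `L²([-1, 1-ρ])` of a tensor-zonal kernel. -/
def zonalNorm {a : ℝ} (ρ : ℝ) (K : Kernel a a) : ℝ :=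
  Real.sqrt (∫ t in (-1 : ℝ)..(1 - ρ), profile K t ^ 2)

/-- Singular values of vectorial upward continuation from radius `r` to radius `R`. -/
def sigma (r R : ℝ) (n : ℕ) : ℝ := (r / R) ^ (n + 1)

/-- The auxiliary symbols `Φ̃^∧(n)`, determined by `Ψ̃^∧(n) = Φ̃^∧(n) - Φ^∧(n) σ_n`. The kernel `Φ`
has maximal degree `N`, and the kernel `Ψ` maximal degree `M`. -/
def auxSymbol (Y : (n : ℕ) → Fin (2 * n + 1) → MvPolynomial (Fin 3) ℝ) (r R : ℝ) (N M : ℕ)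
    (Φ : Kernel r R) (Ψ : Kernel r r) (n : ℕ) : ℝ :=
  symbol Y r r M Ψ n + symbol Y r R N Φ n * sigma r R n

/-- The functional to be minimised. -/
def functional (Y : (n : ℕ) → Fin (2 * n + 1) → MvPolynomial (Fin 3) ℝ) (r R ρ : ℝ) (N M : ℕ)
    (α' α : ℕ → ℝ) (β : ℝ) (Φ : Kernel r R) (Ψ : Kernel r r) : ℝ :=
  ∑ n ∈ Finset.range (M + 1), α' n * |1 - auxSymbol Y r R N M Φ Ψ n| ^ 2
    + ∑ n ∈ Finset.range (N + 1), α n * |1 - symbol Y r R N Φ n * sigma r R n| ^ 2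
    + β * ∑ n ∈ Finset.range (N + 1), |symbol Y r R N Φ n| ^ 2
    + 8 * Real.pi ^ 2 * r ^ 4 * zonalNorm ρ Ψ ^ 2

/-- `(Φ, Ψ)` minimises the functional among the bandlimited tensorial kernels of maximal degrees
`N` and `M`. -/
def IsMinimizer (Y : (n : ℕ) → Fin (2 * n + 1) → MvPolynomial (Fin 3) ℝ) (r R ρ : ℝ) (N M : ℕ)
    (α' α : ℕ → ℝ) (β : ℝ) (Φ : Kernel r R) (Ψ : Kernel r r) : Prop :=
  Φ ∈ Pol Y r R N ∧ Ψ ∈ Pol Y r r M ∧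
    ∀ Φ₁ ∈ Pol Y r R N, ∀ Ψ₁ ∈ Pol Y r r M,
      functional Y r R ρ N M α' α β Φ Ψ ≤ functional Y r R ρ N M α' α β Φ₁ Ψ₁

/-- Legendre polynomials (Rodrigues' formula). -/
def legendre (n : ℕ) : Polynomial ℝ :=
  Polynomial.C (1 / (2 ^ n * (n.factorial : ℝ))) *
    Polynomial.derivative^[n] ((Polynomial.X ^ 2 - 1) ^ n)

/-- The Legendre polynomial `P_n(t)`. -/
def P (n : ℕ) (t : ℝ) : ℝ := (legendre n).eval t

/-- The first derivative of the Legendre polynomial. -/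
def P' (n : ℕ) (t : ℝ) : ℝ := (Polynomial.derivative (legendre n)).eval t

/-- The second derivative of the Legendre polynomial. -/
def P'' (n : ℕ) (t : ℝ) : ℝ :=
  (Polynomial.derivative (Polynomial.derivative (legendre n))).eval t

/-- The Gram entries. -/
def gram (ρ : ℝ) (n m : ℕ) : ℝ :=
  if n = 0 ∨ m = 0 then
    (2 * n + 1) * (2 * m + 1) / 2 * ∫ t in (-1 : ℝ)..(1 - ρ), P n t * P m t
  else
    (2 * n + 1) * (2 * m + 1) / 2 * (∫ t in (-1 : ℝ)..(1 - ρ), P n t * P m t)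
      + (2 * n + 1) * (2 * m + 1) / (2 * n * (n + 1) * m * (m + 1)) *
        ((∫ t in (-1 : ℝ)..(1 - ρ), (1 + t ^ 2) * P' n t * P' m t)
          + (∫ t in (-1 : ℝ)..(1 - ρ), (1 - t ^ 2) ^ 2 * P'' n t * P'' m t)
          - (∫ t in (-1 : ℝ)..(1 - ρ), t * (1 - t ^ 2) * P'' n t * P' m t)
          - (∫ t in (-1 : ℝ)..(1 - ρ), t * (1 - t ^ 2) * P' n t * P'' m t))

/-- The block matrix of the linear system; block indices run through `0,…,N` and `0,…,M`. -/
def systemMatrix (r R ρ : ℝ) (N M : ℕ) (α' α : ℕ → ℝ) (β : ℝ) :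
    Matrix (Fin (N + 1) ⊕ Fin (M + 1)) (Fin (N + 1) ⊕ Fin (M + 1)) ℝ :=
  Matrix.fromBlocks
    (Matrix.diagonal (fun n : Fin (N + 1) => β / sigma r R n ^ 2 + α n)
      + Matrix.of (fun n m : Fin (N + 1) => gram ρ n m))
    (-Matrix.of (fun (n : Fin (N + 1)) (m : Fin (M + 1)) => gram ρ n m))
    (-Matrix.of (fun (n : Fin (M + 1)) (m : Fin (N + 1)) => gram ρ n m))
    (Matrix.diagonal (fun n : Fin (M + 1) => α' n)
      + Matrix.of (fun n m : Fin (M + 1) => gram ρ n m))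

/-- The right-hand side of the linear system. -/
def systemRHS (N M : ℕ) (α' α : ℕ → ℝ) : Fin (N + 1) ⊕ Fin (M + 1) → ℝ :=
  Sum.elim (fun n => α n) (fun n => α' n)

/-- The vector of the `Φ^∧(n) σ_n`, `n = 0,…,N`, followed by the `Φ̃^∧(n)`, `n = 0,…,M`. -/
def symbolVector (Y : (n : ℕ) → Fin (2 * n + 1) → MvPolynomial (Fin 3) ℝ) (r R : ℝ) (N M : ℕ)
    (Φ : Kernel r R) (Ψ : Kernel r r) : Fin (N + 1) ⊕ Fin (M + 1) → ℝ :=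
  Sum.elim (fun n => symbol Y r R N Φ n * sigma r R n) (fun n => auxSymbol Y r R N M Φ Ψ n)

end TensorZonal

end

/-! In terms of the vector `φ = (x, y)` with `x n = Φ^∧(n) σ_n` and `y n = Φ̃^∧(n)`, the symbols of
`Ψ̃` are `y - x`, where `x` is continued by zero beyond `N`. The functional becomes `φᵀMφ - 2 αᵀφ`
plus a constant (`functional_eq`). The system matrix is symmetric and positive definite: the weights
put positive numbers on the diagonal, and the Gram part is a squared norm (`systemMatrix_pos`).
Completing the square then shows that the minimizer is the unique solution of `Mφ = α`. Passing
between pairs of kernels and vectors is a bijection, because symbols are unique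
(`eq_of_kernelOf_eq`) and `σ_n ≠ 0`.

The analytic content is that the zonal norm is the quadratic form of the Gram entries
(`zonalNorm_kernelOf_sq`). This needs the kernels in closed form, hence the addition theorem `∑ Y Y
= (2n+1)/(4π) P_n(ξ·η)`. Harmonic polynomials of degree `n` have dimension at most `2n+1`, so the
given orthonormal system is a basis, and its reproducing kernel is invariant under isometries. With
one argument at the pole the kernel is an axially symmetric harmonic polynomial, whose coefficients
satisfy the Legendre recursion; integrating the diagonal over the sphere fixes the constant.
Differentiating along curves on the sphere in both arguments gives the tangential analogue
(`tangential_addition_theorem`). The Frobenius norm of the resulting tensor is then computed by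
hand. -/

noncomputable section

namespace TensorZonal

/-! ### Homogeneous harmonic polynomials: dimension bound and invariance under isometries. -/

section
open MvPolynomial

/-- The exponent vector of `x^i y^j z^k`. -/
def monoExp (i j k : ℕ) : Fin 3 →₀ ℕ :=
  Finsupp.single 0 i + Finsupp.single 1 j + Finsupp.single 2 k

@[simp] lemma monoExp_zero (i j k : ℕ) : monoExp i j k 0 = i := by simp [monoExp]
@[simp] lemma monoExp_one (i j k : ℕ) : monoExp i j k 1 = j := by simp [monoExp]
@[simp] lemma monoExp_two (i j k : ℕ) : monoExp i j k 2 = k := by simp [monoExp]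

lemma eq_monoExp (m : Fin 3 →₀ ℕ) : m = monoExp (m 0) (m 1) (m 2) := by
  ext i; fin_cases i <;> simp

lemma monoExp_add_single_zero (i j k a : ℕ) :
    monoExp i j k + Finsupp.single 0 a = monoExp (i + a) j k := by
  ext l; fin_cases l <;> simp [monoExp]
lemma monoExp_add_single_one (i j k a : ℕ) :
    monoExp i j k + Finsupp.single 1 a = monoExp i (j + a) k := by
  ext l; fin_cases l <;> simp [monoExp]
lemma monoExp_add_single_two (i j k a : ℕ) :
    monoExp i j k + Finsupp.single 2 a = monoExp i j (k + a) := by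
  ext l; fin_cases l <;> simp [monoExp]

lemma degree_eq_three (m : Fin 3 →₀ ℕ) : m.degree = m 0 + m 1 + m 2 := by
  rw [Finsupp.degree_eq_sum, Fin.sum_univ_three]

/-- The Laplacian on polynomials in three variables. -/
def lap : MvPolynomial (Fin 3) ℝ →ₗ[ℝ] MvPolynomial (Fin 3) ℝ :=
  ∑ i : Fin 3, (pderiv i : Derivation ℝ _ _).toLinearMap ∘ₗ (pderiv i : Derivation ℝ _ _).toLinearMap

lemma lap_apply (p : MvPolynomial (Fin 3) ℝ) : lap p = ∑ i : Fin 3, pderiv i (pderiv i p) := by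
  simp [lap]

lemma coeff_lap (p : MvPolynomial (Fin 3) ℝ) (i j k : ℕ) :
    coeff (monoExp i j k) (lap p) =
      (i + 2) * (i + 1) * coeff (monoExp (i + 2) j k) p
      + (j + 2) * (j + 1) * coeff (monoExp i (j + 2) k) p
      + (k + 2) * (k + 1) * coeff (monoExp i j (k + 2)) p := by
  rw [lap_apply, Fin.sum_univ_three]
  simp only [coeff_add, coeff_pderiv, monoExp_add_single_zero, monoExp_add_single_one,
    monoExp_add_single_two, monoExp_zero, monoExp_one, monoExp_two]
  push_cast
  ring

/-- Homogeneous harmonic polynomials of degree `n`. -/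
def harmonicSubmodule (n : ℕ) : Submodule ℝ (MvPolynomial (Fin 3) ℝ) :=
  homogeneousSubmodule (Fin 3) ℝ n ⊓ LinearMap.ker lap

lemma mem_harmonicSubmodule {n : ℕ} {p : MvPolynomial (Fin 3) ℝ} :
    p ∈ harmonicSubmodule n ↔ p.IsHomogeneous n ∧ lap p = 0 := by
  simp [harmonicSubmodule]

/-- A harmonic polynomial is determined by its coefficients of `z`-degree `0` and `1`. -/
def cauchyData (n : ℕ) :
    MvPolynomial (Fin 3) ℝ →ₗ[ℝ] (Fin (n + 1) → ℝ) × (Fin n → ℝ) :=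
  LinearMap.prod
    (LinearMap.pi fun a : Fin (n + 1) => lcoeff ℝ (monoExp a (n - a) 0))
    (LinearMap.pi fun a : Fin n => lcoeff ℝ (monoExp a (n - 1 - a) 1))

/-- Read through `coeff_lap`, harmonicity is a recursion: a coefficient of `z`-degree `k + 2` is
determined by two coefficients of `z`-degree `k`. -/
lemma eq_zero_of_cauchyData {n : ℕ} {p : MvPolynomial (Fin 3) ℝ} (hp : p ∈ harmonicSubmodule n)
    (h : cauchyData n p = 0) : p = 0 := by
  obtain ⟨hh, hl⟩ := mem_harmonicSubmodule.1 hp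
  have h0 : ∀ a : Fin (n + 1), coeff (monoExp a (n - a) 0) p = 0 := fun a =>
    congrFun (congrArg Prod.fst h) a
  have h1 : ∀ a : Fin n, coeff (monoExp a (n - 1 - a) 1) p = 0 := fun a =>
    congrFun (congrArg Prod.snd h) a
  have key : ∀ k i j : ℕ, i + j + k = n → coeff (monoExp i j k) p = 0 := by
    intro k
    induction k using Nat.strong_induction_on with
    | _ k ih =>
      intro i j hs
      match k, ih with
      | 0, _ =>
        have := h0 ⟨i, by omega⟩
        simp only at this
        rwa [show n - i = j by omega] at this
      | 1, _ =>
        have := h1 ⟨i, by omega⟩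
        simp only at this
        rwa [show n - 1 - i = j by omega] at this
      | k + 2, ih =>
        have e := coeff_lap p i j k
        rw [hl, coeff_zero, ih k (by omega) (i + 2) j (by omega),
          ih k (by omega) i (j + 2) (by omega), mul_zero, mul_zero, zero_add, zero_add] at e
        have : ((k : ℝ) + 2) * (k + 1) ≠ 0 := by positivity
        exact (mul_eq_zero.1 e.symm).resolve_left this
  ext m
  rw [coeff_zero]
  by_cases hm : m.degree = n
  · rw [eq_monoExp m]
    exact key _ _ _ (by rw [← hm, degree_eq_three])
  · exact hh.coeff_eq_zero hm

instance (n : ℕ) : FiniteDimensional ℝ (harmonicSubmodule n) :=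
  FiniteDimensional.of_injective ((cauchyData n).domRestrict (harmonicSubmodule n)) <| by
    rw [← LinearMap.ker_eq_bot, LinearMap.ker_eq_bot']
    intro p hp
    exact Subtype.ext (eq_zero_of_cauchyData p.2 hp)

/-- The Cauchy data have `(n + 1) + n` entries. Only this upper bound is needed, since an
orthonormal system of `2 n + 1` elements supplies the lower one. -/
lemma finrank_harmonicSubmodule_le (n : ℕ) :
    Module.finrank ℝ (harmonicSubmodule n) ≤ 2 * n + 1 := by
  have := LinearMap.finrank_le_finrank_of_injective
    (f := (cauchyData n).domRestrict (harmonicSubmodule n)) <| by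
      rw [← LinearMap.ker_eq_bot, LinearMap.ker_eq_bot']
      intro p hp
      exact Subtype.ext (eq_zero_of_cauchyData p.2 hp)
  simp only [Module.finrank_prod, Module.finrank_fin_fun] at this
  omega

/-- Composition of a polynomial with a linear isometry. -/
def isoComp (f : E3 ≃ₗᵢ[ℝ] E3) : MvPolynomial (Fin 3) ℝ →ₐ[ℝ] MvPolynomial (Fin 3) ℝ :=
  aeval fun i => ∑ j, C (f (EuclideanSpace.single j 1) i) * X j

lemma isometry_apply (f : E3 ≃ₗᵢ[ℝ] E3) (x : E3) (i : Fin 3) :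
    f x i = ∑ j, f (EuclideanSpace.single j 1) i * x j := by
  have hx : x = ∑ j, x j • EuclideanSpace.single j (1 : ℝ) := by
    ext l; simp [Finset.sum_apply, Pi.single_apply]
  conv_lhs => rw [hx]
  simp [mul_comm]

lemma polyFun_isoComp (f : E3 ≃ₗᵢ[ℝ] E3) (p : MvPolynomial (Fin 3) ℝ) (x : E3) :
    polyFun (isoComp f p) x = polyFun p (f x) := by
  unfold polyFun isoComp
  rw [← MvPolynomial.coe_aeval_eq_eval, ← MvPolynomial.coe_aeval_eq_eval]
  simp only [RingHom.coe_coe]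
  rw [← AlgHom.comp_apply, MvPolynomial.comp_aeval]
  congr 2
  ext i
  rw [isometry_apply f x i]
  simp

lemma isoComp_isHomogeneous (f : E3 ≃ₗᵢ[ℝ] E3) {p : MvPolynomial (Fin 3) ℝ} {n : ℕ}
    (hp : p.IsHomogeneous n) : (isoComp f p).IsHomogeneous n := by
  have := hp.aeval (fun i => ∑ j, C (f (EuclideanSpace.single j 1) i) * X j) (n := 1)
    (fun i => IsHomogeneous.sum _ _ _ fun j _ => isHomogeneous_C_mul_X _ _)
  simpa [isoComp] using this

lemma pderiv_isoComp (f : E3 ≃ₗᵢ[ℝ] E3) (j : Fin 3) (p : MvPolynomial (Fin 3) ℝ) :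
    pderiv j (isoComp f p) =
      ∑ i, C (f (EuclideanSpace.single j 1) i) * isoComp f (pderiv i p) := by
  induction p using MvPolynomial.induction_on with
  | C a => simp [isoComp]
  | add p q hp hq => simp only [map_add, hp, hq, mul_add, Finset.sum_add_distrib]
  | mul_X p l hp =>
    have hX : pderiv j (isoComp f (X l)) = C (f (EuclideanSpace.single j 1) l) := by
      simp [isoComp, pderiv_X, Pi.single_apply]
    rw [map_mul, Derivation.leibniz, hp, hX]
    simp only [Derivation.leibniz, pderiv_X, map_add, smul_eq_mul, map_mul, mul_add,
      Finset.sum_add_distrib, Finset.mul_sum]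
    have e1 : ∑ i, C (f (EuclideanSpace.single j 1) i) *
        (isoComp f p * isoComp f ((Pi.single l 1 : Fin 3 → MvPolynomial (Fin 3) ℝ) i))
        = isoComp f p * C (f (EuclideanSpace.single j 1) l) := by
      rw [Finset.sum_eq_single l]
      · rw [Pi.single_eq_same, map_one, mul_one, mul_comm]
      · intro b _ hb
        rw [Pi.single_eq_of_ne hb, map_zero, mul_zero, mul_zero]
      · simp
    rw [← e1]
    refine congrArg₂ _ (Finset.sum_congr rfl fun i _ => ?_)
      (Finset.sum_congr rfl fun i _ => by ring)
    rw [Pi.single_comm]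

/-- The matrix of the inverse isometry is the transpose, so rows of `f` are images of unit vectors
under `f.symm`. -/
lemma isometry_rows (f : E3 ≃ₗᵢ[ℝ] E3) (i i' : Fin 3) :
    ∑ j, f (EuclideanSpace.single j 1) i * f (EuclideanSpace.single j 1) i'
      = if i = i' then 1 else 0 := by
  have h : ∀ j l, f (EuclideanSpace.single j 1) l = f.symm (EuclideanSpace.single l 1) j := by
    intro j l
    have := f.inner_map_map (EuclideanSpace.single j 1) (f.symm (EuclideanSpace.single l (1:ℝ)))
    rw [f.apply_symm_apply] at this
    rw [EuclideanSpace.inner_single_left, EuclideanSpace.inner_single_right] at this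
    simpa using this
  simp only [h]
  have := f.symm.inner_map_map (EuclideanSpace.single i (1:ℝ)) (EuclideanSpace.single i' (1:ℝ))
  rw [PiLp.inner_apply] at this
  simp only [RCLike.inner_apply, conj_trivial] at this
  calc _ = _ := Finset.sum_congr rfl fun j _ => mul_comm _ _
    _ = _ := this
    _ = _ := by simp [EuclideanSpace.inner_single_left]

/-- By the chain rule the second derivatives are contracted with products of matrix rows, and
`isometry_rows` leaves only the trace. -/
lemma lap_isoComp (f : E3 ≃ₗᵢ[ℝ] E3) (p : MvPolynomial (Fin 3) ℝ) :
    lap (isoComp f p) = isoComp f (lap p) := by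
  simp only [lap_apply, pderiv_isoComp, map_sum, pderiv_C_mul, Finset.mul_sum]
  rw [Finset.sum_comm]
  refine Finset.sum_congr rfl fun i _ => ?_
  rw [Finset.sum_comm]
  simp only [← mul_assoc, ← C_mul]
  simp only [← Finset.sum_mul, ← map_sum, isometry_rows]
  simp

lemma isoComp_mem (f : E3 ≃ₗᵢ[ℝ] E3) {p : MvPolynomial (Fin 3) ℝ} {n : ℕ}
    (hp : p ∈ harmonicSubmodule n) : isoComp f p ∈ harmonicSubmodule n := by
  obtain ⟨h1, h2⟩ := mem_harmonicSubmodule.1 hp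
  exact mem_harmonicSubmodule.2 ⟨isoComp_isHomogeneous f h1, by rw [lap_isoComp, h2, map_zero]⟩

end

/-! ### The inner product on the sphere and the reproducing kernel. -/

section
open MvPolynomial MeasureTheory
open scoped Pointwise

lemma polyFun_eq_sum (p : MvPolynomial (Fin 3) ℝ) (x : E3) :
    polyFun p x = ∑ d ∈ p.support, coeff d p * ∏ i, x i ^ d i := by
  rw [polyFun, eval_eq']

lemma differentiable_polyFun (p : MvPolynomial (Fin 3) ℝ) : Differentiable ℝ (polyFun p) := by
  rw [show polyFun p = _ from funext (polyFun_eq_sum p)]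
  fun_prop

lemma continuous_polyFun (p : MvPolynomial (Fin 3) ℝ) : Continuous (polyFun p) :=
  (differentiable_polyFun p).continuous

@[simp] lemma polyFun_add (p q : MvPolynomial (Fin 3) ℝ) (x : E3) :
    polyFun (p + q) x = polyFun p x + polyFun q x := by simp [polyFun]
@[simp] lemma polyFun_smul (c : ℝ) (p : MvPolynomial (Fin 3) ℝ) (x : E3) :
    polyFun (c • p) x = c * polyFun p x := by simp [polyFun, smul_eval]
@[simp] lemma polyFun_zero (x : E3) : polyFun 0 x = 0 := by simp [polyFun]
lemma polyFun_sum {ι : Type*} (s : Finset ι) (p : ι → MvPolynomial (Fin 3) ℝ) (x : E3) :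
    polyFun (∑ i ∈ s, p i) x = ∑ i ∈ s, polyFun (p i) x := by
  simp [polyFun]

/-- The action of a linear isometry on the unit sphere. -/
def sphereMap (f : E3 ≃ₗᵢ[ℝ] E3) : Sph 1 ≃ₜ Sph 1 where
  toFun ξ := ⟨f ξ, by simp⟩
  invFun ξ := ⟨f.symm ξ, by simp⟩
  left_inv ξ := by simp
  right_inv ξ := by simp
  continuous_toFun := by fun_prop
  continuous_invFun := by fun_prop

@[simp] lemma coe_sphereMap (f : E3 ≃ₗᵢ[ℝ] E3) (ξ : Sph 1) : (sphereMap f ξ : E3) = f ξ := rfl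

/-- The surface measure of the unit sphere. -/
abbrev sphMeasure : Measure (Sph 1) := (volume : Measure E3).toSphere

/-- `toSphere` measures a set by the volume of the cone over it; a linear isometry maps cones to
cones and preserves volume. -/
lemma measurePreserving_sphereMap (f : E3 ≃ₗᵢ[ℝ] E3) :
    MeasurePreserving (sphereMap f) sphMeasure sphMeasure := by
  refine ⟨(sphereMap f).continuous.measurable, ?_⟩
  ext s hs
  rw [Measure.map_apply (sphereMap f).continuous.measurable hs, Measure.toSphere_apply' _ hs,
    Measure.toSphere_apply' _ ((sphereMap f).continuous.measurable hs)]
  congr 1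
  have : Set.Ioo (0 : ℝ) 1 • ((↑) '' (sphereMap f ⁻¹' s) : Set E3)
      = f ⁻¹' (Set.Ioo (0 : ℝ) 1 • ((↑) '' s)) := by
    ext x
    simp only [Set.mem_smul, Set.mem_image, Set.mem_preimage, Set.mem_Ioo]
    constructor
    · rintro ⟨c, hc, _, ⟨ξ, hξ, rfl⟩, rfl⟩
      exact ⟨c, hc, _, ⟨_, hξ, rfl⟩, by simp⟩
    · rintro ⟨c, hc, _, ⟨ξ, hξ, rfl⟩, h⟩
      refine ⟨c, hc, _, ⟨(sphereMap f).symm ξ, by simpa using hξ, rfl⟩, ?_⟩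
      apply f.injective
      rw [← h, map_smul, ← coe_sphereMap, Homeomorph.apply_symm_apply]
  rw [this]
  exact f.measurePreserving.measure_preimage_emb f.toHomeomorph.measurableEmbedding _

lemma integral_sphere_comp (f : E3 ≃ₗᵢ[ℝ] E3) (F : E3 → ℝ) :
    ∫ ξ : Sph 1, F (f ξ) ∂sphMeasure = ∫ ξ : Sph 1, F ξ ∂sphMeasure :=
  (measurePreserving_sphereMap f).integral_comp (sphereMap f).measurableEmbedding
    (fun ξ : Sph 1 => F ξ)

lemma integrable_sphere {F : Sph 1 → ℝ} (hF : Continuous F) : Integrable F sphMeasure :=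
  hF.integrable_of_hasCompactSupport (HasCompactSupport.of_compactSpace F)

lemma integrable_polyFun_mul (p q : MvPolynomial (Fin 3) ℝ) :
    Integrable (fun ξ : Sph 1 => polyFun p (ξ : E3) * polyFun q (ξ : E3)) sphMeasure :=
  integrable_sphere (((continuous_polyFun p).comp continuous_subtype_val).mul
    ((continuous_polyFun q).comp continuous_subtype_val))

lemma sphMeasure_real_univ : sphMeasure.real Set.univ = 4 * Real.pi := by
  rw [Measure.toSphere_real_apply_univ, measureReal_def, EuclideanSpace.volume_ball_fin_three]
  have h : 0 ≤ Real.pi * 4 / 3 := by positivity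
  simp [ENNReal.toReal_ofReal h]
  ring

/-- The inner product of `L²` of the unit sphere, on polynomials. -/
def sphForm (p q : MvPolynomial (Fin 3) ℝ) : ℝ :=
  ∫ ξ : Sph 1, polyFun p (ξ : E3) * polyFun q (ξ : E3) ∂sphMeasure

lemma sphForm_comm (p q : MvPolynomial (Fin 3) ℝ) : sphForm p q = sphForm q p := by
  simp only [sphForm, mul_comm]

lemma sphForm_sum_left {ι : Type*} (s : Finset ι) (c : ι → ℝ) (p : ι → MvPolynomial (Fin 3) ℝ)
    (q : MvPolynomial (Fin 3) ℝ) :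
    sphForm (∑ i ∈ s, c i • p i) q = ∑ i ∈ s, c i * sphForm (p i) q := by
  simp only [sphForm, polyFun_sum, polyFun_smul, Finset.sum_mul, mul_assoc]
  rw [integral_finsetSum _ fun i _ => (integrable_polyFun_mul (p i) q).const_mul (c i)]
  simp only [integral_const_mul]

lemma sphForm_sum_right {ι : Type*} (s : Finset ι) (c : ι → ℝ) (p : ι → MvPolynomial (Fin 3) ℝ)
    (q : MvPolynomial (Fin 3) ℝ) :
    sphForm q (∑ i ∈ s, c i • p i) = ∑ i ∈ s, c i * sphForm q (p i) := by
  simp only [sphForm_comm q, sphForm_sum_left]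

lemma sphForm_isoComp (f : E3 ≃ₗᵢ[ℝ] E3) (p q : MvPolynomial (Fin 3) ℝ) :
    sphForm (isoComp f p) (isoComp f q) = sphForm p q := by
  simp only [sphForm, polyFun_isoComp]
  exact integral_sphere_comp f fun x => polyFun p x * polyFun q x

variable {Y : (n : ℕ) → Fin (2 * n + 1) → MvPolynomial (Fin 3) ℝ}

namespace IsSphericalHarmonics

lemma sphForm_same (hY : IsSphericalHarmonics Y) (n : ℕ) (k l : Fin (2 * n + 1)) :
    sphForm (Y n k) (Y n l) = if k = l then 1 else 0 := by
  rw [sphForm, hY.orthonormal n k n l]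
  simp

lemma sphForm_of_ne (hY : IsSphericalHarmonics Y) {n m : ℕ} (h : n ≠ m) (k : Fin (2 * n + 1))
    (l : Fin (2 * m + 1)) : sphForm (Y n k) (Y m l) = 0 := by
  rw [sphForm, hY.orthonormal n k m l, if_neg]
  intro e
  exact h (congrArg Sigma.fst e)

lemma mem (hY : IsSphericalHarmonics Y) (n : ℕ) (k : Fin (2 * n + 1)) :
    Y n k ∈ harmonicSubmodule n :=
  mem_harmonicSubmodule.2 ⟨hY.homogeneous n k, by rw [lap_apply]; exact hY.harmonic n k⟩

/-- Spherical harmonics of degree `n` span the harmonic polynomials of degree `n`. -/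
lemma expansion (hY : IsSphericalHarmonics Y) {n : ℕ} {p : MvPolynomial (Fin 3) ℝ}
    (hp : p ∈ harmonicSubmodule n) : p = ∑ k, sphForm p (Y n k) • Y n k := by
  have hli : LinearIndependent ℝ (fun k => (⟨Y n k, hY.mem n k⟩ : harmonicSubmodule n)) := by
    rw [Fintype.linearIndependent_iff]
    intro g hg k
    have h1 : ∑ k, g k • Y n k = 0 := by
      simpa using congrArg Subtype.val hg
    have h2 := sphForm_sum_left Finset.univ g (Y n) (Y n k)
    have h0 : sphForm 0 (Y n k) = 0 := by simp [sphForm]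
    rw [h1, h0] at h2
    simpa [sphForm_same hY] using h2.symm
  -- Here `2 n + 1` independent elements meet the dimension bound `2 n + 1`, so they span.
  have hcard : Fintype.card (Fin (2 * n + 1)) = Module.finrank ℝ (harmonicSubmodule n) :=
    le_antisymm hli.fintype_card_le_finrank (by simpa using finrank_harmonicSubmodule_le n)
  have hsp := hli.span_eq_top_of_card_eq_finrank' hcard
  have hmem : (⟨p, hp⟩ : harmonicSubmodule n) ∈
      Submodule.span ℝ (Set.range fun k => (⟨Y n k, hY.mem n k⟩ : harmonicSubmodule n)) := by
    rw [hsp]; trivial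
  obtain ⟨c, hc⟩ := (Submodule.mem_span_range_iff_exists_fun ℝ).1 hmem
  have hc' : ∑ k, c k • Y n k = p := by simpa using congrArg Subtype.val hc
  have : ∀ k, sphForm p (Y n k) = c k := by
    intro k
    rw [← hc', sphForm_sum_left]
    simp [sphForm_same hY]
  simp only [this, hc']

end IsSphericalHarmonics

/-- The reproducing kernel of the spherical harmonics of degree `n`. -/
def repKernel (Y : (n : ℕ) → Fin (2 * n + 1) → MvPolynomial (Fin 3) ℝ) (n : ℕ) (x y : E3) : ℝ :=
  ∑ k, polyFun (Y n k) x * polyFun (Y n k) y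

/-- The reproducing kernel is invariant under isometries. -/
lemma repKernel_isometry (hY : IsSphericalHarmonics Y) (n : ℕ) (f : E3 ≃ₗᵢ[ℝ] E3) (x y : E3) :
    repKernel Y n (f x) (f y) = repKernel Y n x y := by
  set A : Matrix (Fin (2 * n + 1)) (Fin (2 * n + 1)) ℝ :=
    Matrix.of fun k l => sphForm (isoComp f (Y n k)) (Y n l) with hA
  have hexp : ∀ k, isoComp f (Y n k) = ∑ l, A k l • Y n l := fun k =>
    hY.expansion (isoComp_mem f (hY.mem n k))
  have h1 : A * A.transpose = 1 := by
    ext k m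
    have := sphForm_isoComp f (Y n k) (Y n m)
    rw [hexp k, hexp m, sphForm_sum_left] at this
    simp only [sphForm_sum_right, hY.sphForm_same] at this
    simpa [Matrix.mul_apply, Matrix.one_apply] using this
  -- Invariance of the form gives orthonormal rows; the sum over `k` below needs orthonormal
  -- columns.
  have h2 : A.transpose * A = 1 := mul_eq_one_comm.1 h1
  have hval : ∀ k z, polyFun (Y n k) (f z) = ∑ l, A k l * polyFun (Y n l) z := by
    intro k z
    rw [← polyFun_isoComp, hexp k, polyFun_sum]
    simp
  have h3 : ∀ l m, ∑ k, A k l * A k m = if l = m then 1 else 0 := by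
    intro l m
    have := congrFun (congrFun h2 l) m
    simpa [Matrix.mul_apply, Matrix.one_apply] using this
  unfold repKernel
  simp only [hval, Finset.sum_mul_sum]
  rw [Finset.sum_comm]
  refine Finset.sum_congr rfl fun l _ => ?_
  rw [Finset.sum_comm]
  have : ∀ m, ∑ k, A k l * polyFun (Y n l) x * (A k m * polyFun (Y n m) y)
      = (if l = m then 1 else 0) * (polyFun (Y n l) x * polyFun (Y n m) y) := by
    intro m
    rw [← h3 l m, Finset.sum_mul]
    exact Finset.sum_congr rfl fun k _ => by ring
  simp [this]

end

/-! ### Legendre polynomials and the addition theorem. -/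

section
section Legendre
open Polynomial

/-- The explicit form of Rodrigues' formula. -/
lemma P_eq_sum (n : ℕ) (t : ℝ) :
    P n t = ∑ j ∈ Finset.range (n + 1),
      (1 / 2 ^ n) * (n.choose j * (n - j).choose j) * (t ^ 2 - 1) ^ j * (2 * t) ^ (n - j - j) := by
  -- The `n`-th derivative is `n!` times the `n`-th Taylor coefficient at `t`. Since `(X + t)² - 1 =
  -- (t² - 1) + X (X + 2t)`, two binomial expansions yield it.
  have h1 : (derivative^[n] ((X ^ 2 - 1 : ℝ[X]) ^ n)).eval t
      = n.factorial * (taylor t ((X ^ 2 - 1 : ℝ[X]) ^ n)).coeff n := by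
    rw [← factorial_smul_hasseDeriv, taylor_coeff]
    simp
  have h2 : taylor t ((X ^ 2 - 1 : ℝ[X]) ^ n)
      = (Polynomial.C (t ^ 2 - 1) + X * (X + Polynomial.C (2 * t))) ^ n := by
    rw [taylor_pow]
    congr 1
    simp only [map_sub, map_pow, taylor_pow, taylor_X, taylor_one, map_one, map_mul]
    simp only [map_ofNat]
    ring
  have h3 : (taylor t ((X ^ 2 - 1 : ℝ[X]) ^ n)).coeff n
      = ∑ j ∈ Finset.range (n + 1),
        (n.choose j * (n - j).choose j) * (t ^ 2 - 1) ^ j * (2 * t) ^ (n - j - j) := by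
    rw [h2, add_pow, finsetSum_coeff]
    refine Finset.sum_congr rfl fun j hj => ?_
    have hj' : j ≤ n := Nat.lt_succ_iff.1 (Finset.mem_range.1 hj)
    rw [← Polynomial.C_pow, mul_pow, ← Polynomial.C_eq_natCast, Polynomial.coeff_mul_C,
      Polynomial.coeff_C_mul, Polynomial.coeff_X_pow_mul', if_pos (Nat.sub_le n j),
      Polynomial.coeff_X_add_C_pow, Nat.sub_sub_self hj']
    ring
  have hf : (n.factorial : ℝ) ≠ 0 := by positivity
  rw [P, legendre, Polynomial.eval_mul, Polynomial.eval_C, h1, h3, Finset.mul_sum, Finset.mul_sum]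
  refine Finset.sum_congr rfl fun j _ => ?_
  field_simp

end Legendre

open MvPolynomial MeasureTheory

/-- The product of binomials is `n! / (j!² (n - 2j)!)`, so this is the ratio of consecutive
coefficients in `P_eq_sum`. -/
lemma choose_mul_choose_recursion {n j : ℕ} (h : 2 * (j + 1) ≤ n) :
    (((j : ℝ) + 1) ^ 2) * (n.choose (j + 1) * (n - (j + 1)).choose (j + 1))
      = (n - 2 * j) * (n - 2 * j - 1) * (n.choose j * (n - j).choose j) := by
  obtain ⟨m, rfl⟩ : ∃ m, n = m + 2 * (j + 1) := ⟨n - 2 * (j + 1), by omega⟩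
  have h1 := Nat.choose_mul_factorial_mul_factorial (n := m + 2 * (j + 1)) (k := j + 1) (by omega)
  have h2 := Nat.choose_mul_factorial_mul_factorial (n := m + 2 * (j + 1) - (j + 1)) (k := j + 1)
    (by omega)
  have h3 := Nat.choose_mul_factorial_mul_factorial (n := m + 2 * (j + 1)) (k := j) (by omega)
  have h4 := Nat.choose_mul_factorial_mul_factorial (n := m + 2 * (j + 1) - j) (k := j) (by omega)
  rw [show m + 2 * (j + 1) - (j + 1) - (j + 1) = m by omega] at h2
  rw [show m + 2 * (j + 1) - j - j = m + 2 by omega] at h4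
  rw [← h2] at h1
  rw [← h4] at h3
  rw [← h3] at h1
  simp only [Nat.factorial_succ] at h1
  generalize (m + 2 * (j + 1)).choose (j + 1) = a at *
  generalize (m + 2 * (j + 1) - (j + 1)).choose (j + 1) = b at *
  generalize (m + 2 * (j + 1)).choose j = c at *
  generalize (m + 2 * (j + 1) - j).choose j = d at *
  have hj : (j.factorial : ℝ) ≠ 0 := by positivity
  have hm : (m.factorial : ℝ) ≠ 0 := by positivity
  have h5 := congrArg (Nat.cast (R := ℝ)) h1
  push_cast at h5 ⊢
  have : ((j.factorial : ℝ) ^ 2 * m.factorial) *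
      ((((j : ℝ) + 1) ^ 2) * (a * b)) = (j.factorial ^ 2 * m.factorial) *
        ((m + 2 * (j + 1) - 2 * j) * (m + 2 * (j + 1) - 2 * j - 1) * (c * d)) := by
    linear_combination h5
  exact mul_left_cancel₀ (by positivity) this

lemma sum_range_two_mul_eq (f : ℕ → ℝ) (m : ℕ) :
    ∑ i ∈ Finset.range (2 * m), f i = ∑ j ∈ Finset.range m, (f (2 * j) + f (2 * j + 1)) := by
  induction m with
  | zero => simp
  | succ m ih =>
    rw [show 2 * (m + 1) = 2 * m + 1 + 1 by ring, Finset.sum_range_succ, Finset.sum_range_succ, ih,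
      Finset.sum_range_succ]
    ring

/-- The values of a homogeneous polynomial in the plane `y = 0`. -/
lemma polyFun_plane {n : ℕ} {p : MvPolynomial (Fin 3) ℝ} (hp : p.IsHomogeneous n) {x : E3}
    (hx : x 1 = 0) :
    polyFun p x = ∑ i ∈ Finset.range (2 * (n + 1)),
      coeff (monoExp i 0 (n - i)) p * (x 0 ^ i * x 2 ^ (n - i)) := by
  classical
  rw [polyFun_eq_sum]
  set g : (Fin 3 →₀ ℕ) → ℝ := fun d => coeff d p * ∏ i, x i ^ d i with hg
  have hinj : Set.InjOn (fun i => monoExp i 0 (n - i)) (Finset.range (2 * (n + 1)) : Set ℕ) := by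
    intro a _ b _ h
    simpa using DFunLike.congr_fun h 0
  -- The range exceeds `n + 1` so that it splits into even and odd indices later; for `i > n` the
  -- exponent has degree `i ≠ n` and its coefficient is zero.
  set S := (Finset.range (2 * (n + 1))).image fun i => monoExp i 0 (n - i) with hS
  have e1 : ∑ d ∈ p.support, g d = ∑ d ∈ p.support ∪ S, g d := by
    refine Finset.sum_subset Finset.subset_union_left fun d _ hd => ?_
    simp [hg, notMem_support_iff.1 hd]
  have e2 : ∑ d ∈ S, g d = ∑ d ∈ p.support ∪ S, g d := by
    refine Finset.sum_subset Finset.subset_union_right fun d _ hd => ?_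
    by_cases h1 : d 1 = 0
    · by_cases h2 : d.degree = n
      · exfalso
        apply hd
        rw [degree_eq_three, h1] at h2
        refine Finset.mem_image.2 ⟨d 0, Finset.mem_range.2 (by omega), ?_⟩
        conv_rhs => rw [eq_monoExp d, h1]
        congr 1
        omega
      · simp [hg, hp.coeff_eq_zero h2]
    · simp [hg, Fin.prod_univ_three, hx, h1]
  rw [e1, ← e2, hS, Finset.sum_image hinj]
  refine Finset.sum_congr rfl fun i _ => ?_
  simp [hg, Fin.prod_univ_three]

/-- The infinitesimal rotation about the third axis. -/
def rotGen (p : MvPolynomial (Fin 3) ℝ) : MvPolynomial (Fin 3) ℝ :=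
  X 0 * pderiv 1 p - X 1 * pderiv 0 p

/-- For axially symmetric `p` this relates the `y²`-coefficients to those in the plane `y = 0`, so
that they can be eliminated from the Laplace recursion. -/
lemma coeff_rotGen (p : MvPolynomial (Fin 3) ℝ) (i k : ℕ) :
    coeff (monoExp (i + 1) 1 k) (rotGen p)
      = 2 * coeff (monoExp i 2 k) p - (i + 2) * coeff (monoExp (i + 2) 0 k) p := by
  have h0 : monoExp (i + 1) 1 k = Finsupp.single 0 1 + monoExp i 1 k := by
    rw [add_comm (Finsupp.single _ _), monoExp_add_single_zero]
  have h1 : monoExp (i + 1) 1 k = Finsupp.single 1 1 + monoExp (i + 1) 0 k := by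
    rw [add_comm (Finsupp.single _ _), monoExp_add_single_one]
  rw [rotGen, coeff_sub]
  nth_rewrite 1 [h0]
  rw [h1, coeff_X_mul, coeff_X_mul, coeff_pderiv, coeff_pderiv, monoExp_add_single_one,
    monoExp_add_single_zero]
  simp
  ring

lemma coeff_rotGen_zero (p : MvPolynomial (Fin 3) ℝ) (k : ℕ) :
    coeff (monoExp 0 1 k) (rotGen p) = - coeff (monoExp 1 0 k) p := by
  have h1 : monoExp 0 1 k = Finsupp.single 1 1 + monoExp 0 0 k := by
    rw [add_comm (Finsupp.single _ _), monoExp_add_single_one]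
  rw [rotGen, coeff_sub, coeff_X_mul', if_neg (by simp), h1, coeff_X_mul, coeff_pderiv,
    monoExp_add_single_zero]
  simp

/-- An axially symmetric harmonic polynomial is a multiple of the Legendre polynomial. -/
lemma zonal_eq_legendre {n : ℕ} {p : MvPolynomial (Fin 3) ℝ} (hp : p ∈ harmonicSubmodule n)
    (hrot : rotGen p = 0) {x : E3} (hx : x 1 = 0) (hnorm : x 0 ^ 2 + x 2 ^ 2 = 1) :
    polyFun p x = polyFun p (EuclideanSpace.single 2 1) * P n (x 2) := by
  obtain ⟨hh, hl⟩ := mem_harmonicSubmodule.1 hp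
  set a : ℕ → ℝ := fun i => coeff (monoExp i 0 (n - i)) p with ha
  have hbig : ∀ i, n < i → a i = 0 := fun i hi =>
    hh.coeff_eq_zero (by rw [degree_eq_three]; simp; omega)
  have hrec : ∀ i, i + 2 ≤ n →
      ((i : ℝ) + 2) ^ 2 * a (i + 2) = -((n - i) * (n - i - 1) * a i) := by
    intro i hi
    -- The coefficient of `x^i y² z^(n-i-2)` occurs in both relations; eliminating it leaves a
    -- two-term recursion in `a`.
    have h1 := coeff_lap p i 0 (n - (i + 2))
    have h2 := coeff_rotGen p i (n - (i + 2))
    rw [hl, coeff_zero] at h1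
    rw [hrot, coeff_zero] at h2
    rw [show n - (i + 2) + 2 = n - i by omega] at h1
    rw [Nat.cast_sub hi] at h1
    push_cast at h1
    simp only [ha]
    linear_combination -h1 + h2
  have hodd : ∀ j, a (2 * j + 1) = 0 := by
    intro j
    induction j with
    | zero =>
      have := coeff_rotGen_zero p (n - 1)
      rw [hrot, coeff_zero] at this
      simp only [ha]
      linarith
    | succ j ih =>
      by_cases hj : 2 * j + 1 + 2 ≤ n
      · have := hrec _ hj
        rw [ih, mul_zero, neg_zero] at this
        exact (mul_eq_zero.1 this).resolve_left (by positivity)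
      · exact hbig _ (by omega)
  have heven : ∀ j, 2 * j ≤ n →
      a (2 * j) = (-1) ^ j * (1 / 4 ^ j) * (n.choose j * (n - j).choose j) * a 0 := by
    intro j
    induction j with
    | zero => intro _; simp
    | succ j ih =>
      intro hj
      have h1 := hrec (2 * j) (by omega)
      rw [ih (by omega)] at h1
      have h2 := choose_mul_choose_recursion hj
      have hj0 : ((2 * j : ℕ) + 2 : ℝ) ^ 2 ≠ 0 := by positivity
      apply mul_left_cancel₀ hj0
      rw [show 2 * (j + 1) = 2 * j + 2 by ring, h1]
      push_cast
      rw [pow_succ, pow_succ]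
      linear_combination (-1) ^ j * (1 / 4 ^ j) * a 0 * h2
  have hpole : polyFun p (EuclideanSpace.single 2 1) = a 0 := by
    rw [polyFun_plane hh (by simp), Finset.sum_eq_single 0]
    · simp [ha]
    · intro i _ hi
      simp [hi]
    · simp
  rw [hpole, polyFun_plane hh hx, sum_range_two_mul_eq, P_eq_sum, Finset.mul_sum]
  refine Finset.sum_congr rfl fun j _ => ?_
  change a (2 * j) * _ + a (2 * j + 1) * _ = _
  rw [hodd, zero_mul, add_zero]
  by_cases hj : 2 * j ≤ n
  · have hs : x 0 ^ (2 * j) = (-1) ^ j * (x 2 ^ 2 - 1) ^ j := by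
      rw [pow_mul, ← mul_pow]
      congr 1
      linarith
    have h2 : (2 : ℝ) ^ n = 4 ^ j * 2 ^ (n - j - j) := by
      rw [show (4 : ℝ) = 2 ^ 2 by norm_num, ← pow_mul, ← pow_add]
      congr 1
      omega
    rw [heven j hj, hs, mul_pow, h2, show n - 2 * j = n - j - j by omega]
    have h1 : ((-1 : ℝ) ^ j) * (-1) ^ j = 1 := by rw [← mul_pow]; simp
    field_simp
    linear_combination (n.choose j * (n - j).choose j * a 0 * (x 2 ^ 2 - 1) ^ j
      * x 2 ^ (n - j - j)) * h1
  · rw [hbig _ (by omega), Nat.choose_eq_zero_of_lt (n := n - j) (k := j) (by omega)]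
    simp

lemma hasDerivAt_polyFun_comp (p : MvPolynomial (Fin 3) ℝ) {γ : ℝ → E3} {γ' : Fin 3 → ℝ} {t : ℝ}
    (h : ∀ i, HasDerivAt (fun s => γ s i) (γ' i) t) :
    HasDerivAt (fun s => polyFun p (γ s)) (∑ i, polyFun (pderiv i p) (γ t) * γ' i) t := by
  induction p using MvPolynomial.induction_on with
  | C a => simpa [polyFun] using hasDerivAt_const t a
  | add p q hp hq =>
    simp only [map_add, polyFun_add, add_mul, Finset.sum_add_distrib]
    exact hp.add hq
  | mul_X p l hp =>
    have e : (fun s => polyFun (p * X l) (γ s)) = fun s => polyFun p (γ s) * γ s l := by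
      ext s; simp [polyFun]
    rw [e]
    refine (hp.fun_mul (h l)).congr_deriv ?_
    symm
    simp only [polyFun, Derivation.leibniz, pderiv_X, smul_eq_mul, map_add, map_mul, eval_X,
      add_mul, Finset.sum_add_distrib]
    rw [add_comm, Finset.sum_mul]
    congr 1
    · exact Finset.sum_congr rfl fun i _ => by ring
    · rw [Finset.sum_eq_single l]
      · simp
      · intro b _ hb
        simp [Pi.single_eq_of_ne' hb]
      · simp

/-- At each point, `rotGen p` is the derivative of `p` along the rotation orbit through that point,
and `p` is constant on the orbit. -/
lemma rotGen_eq_zero {p : MvPolynomial (Fin 3) ℝ}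
    (h : ∀ x x' : E3, ‖x‖ = ‖x'‖ → x 2 = x' 2 → polyFun p x = polyFun p x') : rotGen p = 0 := by
  apply MvPolynomial.funext
  intro v
  let γ : ℝ → E3 := fun θ =>
    !₂[Real.cos θ * v 0 - Real.sin θ * v 1, Real.sin θ * v 0 + Real.cos θ * v 1, v 2]
  have hγ0 : γ 0 = WithLp.toLp 2 v := by
    ext i; fin_cases i <;> simp [γ]
  have h1 := hasDerivAt_polyFun_comp p (γ := γ) (γ' := ![-v 1, v 0, 0]) (t := 0) (by
    intro i
    fin_cases i
    · have := ((Real.hasDerivAt_cos 0).mul_const (v 0)).fun_sub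
        ((Real.hasDerivAt_sin 0).mul_const (v 1))
      simpa [γ] using this
    · have := ((Real.hasDerivAt_sin 0).mul_const (v 0)).fun_add
        ((Real.hasDerivAt_cos 0).mul_const (v 1))
      simpa [γ] using this
    · simpa [γ] using hasDerivAt_const (0 : ℝ) (v 2))
  have h2 : (fun s => polyFun p (γ s)) = fun _ => polyFun p (γ 0) := by
    ext s
    apply h
    · rw [EuclideanSpace.norm_eq, EuclideanSpace.norm_eq]
      congr 1
      simp only [Fin.sum_univ_three, Real.norm_eq_abs, sq_abs, γ]
      simp
      linear_combination (v 0 ^ 2 + v 1 ^ 2) * Real.sin_sq_add_cos_sq s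
    · simp [γ]
  rw [h2] at h1
  have h3 := h1.unique (hasDerivAt_const (0 : ℝ) (polyFun p (γ 0)))
  rw [hγ0] at h3
  simp only [Fin.sum_univ_three, polyFun] at h3
  simp only [rotGen, map_sub, map_mul, eval_X, map_zero]
  simp at h3
  linarith

variable {Y : (n : ℕ) → Fin (2 * n + 1) → MvPolynomial (Fin 3) ℝ}

/-- The reflection in the plane orthogonal to `x - x'` works, because `y` lies in that plane. -/
lemma exists_isometry_fixing {x x' y : E3} (h : ‖x‖ = ‖x'‖) (hy : inner ℝ x y = inner ℝ x' y) :
    ∃ f : E3 ≃ₗᵢ[ℝ] E3, f x = x' ∧ f y = y := by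
  refine ⟨Submodule.reflection (ℝ ∙ (x - x'))ᗮ, Submodule.reflection_sub h, ?_⟩
  apply Submodule.reflection_mem_subspace_eq_self
  rw [Submodule.mem_orthogonal_singleton_iff_inner_right, inner_sub_left, hy, sub_self]

lemma exists_isometry_map {x x' : E3} (h : ‖x‖ = ‖x'‖) : ∃ f : E3 ≃ₗᵢ[ℝ] E3, f x = x' :=
  ⟨Submodule.reflection (ℝ ∙ (x - x'))ᗮ, Submodule.reflection_sub h⟩

lemma repKernel_eq_of_inner_eq (hY : IsSphericalHarmonics Y) (n : ℕ) {x x' y : E3}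
    (h : ‖x‖ = ‖x'‖) (hy : inner ℝ x y = inner ℝ x' y) :
    repKernel Y n x y = repKernel Y n x' y := by
  obtain ⟨f, hf1, hf2⟩ := exists_isometry_fixing h hy
  rw [← repKernel_isometry hY n f, hf1, hf2]

/-- By invariance the diagonal is constant on the sphere. Its integral counts the `2 n + 1`
normalised functions, and the area is `4π`. -/
lemma repKernel_diag (hY : IsSphericalHarmonics Y) (n : ℕ) {x : E3} (hx : ‖x‖ = 1) :
    repKernel Y n x x = (2 * n + 1) / (4 * Real.pi) := by
  have hconst : ∀ ξ : Sph 1, repKernel Y n (ξ : E3) ξ = repKernel Y n x x := by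
    intro ξ
    obtain ⟨f, hf⟩ := exists_isometry_map (x := (ξ : E3)) (x' := x) (by simp [hx])
    rw [← repKernel_isometry hY n f, hf]
  have h1 : ∫ ξ : Sph 1, repKernel Y n (ξ : E3) ξ ∂sphMeasure = 2 * n + 1 := by
    unfold repKernel
    rw [integral_finsetSum _ fun k _ => integrable_polyFun_mul (Y n k) (Y n k)]
    have : ∀ k, ∫ ξ : Sph 1, polyFun (Y n k) (ξ : E3) * polyFun (Y n k) (ξ : E3) ∂sphMeasure = 1 :=
      fun k => by
        have := hY.sphForm_same n k k
        rwa [if_pos rfl] at this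
    simp [this]
  simp only [hconst, integral_const, sphMeasure_real_univ, smul_eq_mul] at h1
  have hpi : 4 * Real.pi ≠ 0 := by positivity
  rw [eq_div_iff hpi, ← h1, mul_comm]

/-- The addition theorem for spherical harmonics. -/
theorem addition_theorem (hY : IsSphericalHarmonics Y) (n : ℕ) {x y : E3} (hx : ‖x‖ = 1)
    (hy : ‖y‖ = 1) :
    repKernel Y n x y = (2 * n + 1) / (4 * Real.pi) * P n (inner ℝ x y) := by
  set e : E3 := EuclideanSpace.single 2 1 with he
  have hen : ‖e‖ = 1 := by simp [he]
  obtain ⟨f, hf⟩ := exists_isometry_map (x := y) (x' := e) (by rw [hy, hen])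
  have hin : inner ℝ x y = inner ℝ (f x) e := by rw [← hf, f.inner_map_map]
  rw [← repKernel_isometry hY n f, hf, hin]
  have hz : ‖f x‖ = 1 := by simp [hx]
  generalize f x = z at hz
  have hze : inner ℝ z e = z 2 := by simp [he, EuclideanSpace.inner_single_right]
  have hsq : z 0 ^ 2 + z 1 ^ 2 + z 2 ^ 2 = 1 := by
    rw [EuclideanSpace.norm_eq, Real.sqrt_eq_one] at hz
    simpa [Fin.sum_univ_three] using hz
  -- `w` is `z` turned about the pole axis into the plane `y = 0`, where `zonal_eq_legendre`
  -- applies.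
  set w : E3 := !₂[Real.sqrt (z 0 ^ 2 + z 1 ^ 2), 0, z 2] with hw
  have hw0 : w 0 = Real.sqrt (z 0 ^ 2 + z 1 ^ 2) := by simp [hw]
  have hw1 : w 1 = 0 := by simp [hw]
  have hw2 : w 2 = z 2 := by simp [hw]
  have hwsq : w 0 ^ 2 + w 2 ^ 2 = 1 := by
    rw [hw0, hw2, Real.sq_sqrt (by positivity)]
    linarith
  have hwn : ‖w‖ = 1 := by
    rw [EuclideanSpace.norm_eq, Real.sqrt_eq_one]
    simp only [Fin.sum_univ_three, Real.norm_eq_abs, sq_abs, hw1]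
    linarith
  have hwe : inner ℝ w e = w 2 := by simp [he, EuclideanSpace.inner_single_right]
  rw [repKernel_eq_of_inner_eq hY n (x' := w) (by rw [hz, hwn]) (by rw [hze, hwe, hw2])]
  set p : MvPolynomial (Fin 3) ℝ := ∑ k, polyFun (Y n k) e • Y n k with hp
  have hpv : ∀ v, polyFun p v = repKernel Y n v e := by
    intro v
    rw [hp, polyFun_sum, repKernel]
    exact Finset.sum_congr rfl fun k _ => by rw [polyFun_smul, mul_comm]
  have hpm : p ∈ harmonicSubmodule n :=
    Submodule.sum_mem _ fun k _ => Submodule.smul_mem _ _ (hY.mem n k)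
  have hrot : rotGen p = 0 := by
    apply rotGen_eq_zero
    intro v v' h1 h2
    rw [hpv, hpv]
    apply repKernel_eq_of_inner_eq hY n h1
    simpa [he, EuclideanSpace.inner_single_right] using h2
  rw [← hpv, zonal_eq_legendre hpm hrot hw1 hwsq, ← he, hpv, repKernel_diag hY n hen, hze, hw2]

end

/-! ### The tangential addition theorem and the entries of the kernels. -/

section
open MvPolynomial MeasureTheory

variable {Y : (n : ℕ) → Fin (2 * n + 1) → MvPolynomial (Fin 3) ℝ}

lemma hasDerivAt_P (n : ℕ) (t : ℝ) : HasDerivAt (P n) (P' n t) t := (legendre n).hasDerivAt t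

lemma hasDerivAt_P' (n : ℕ) (t : ℝ) : HasDerivAt (P' n) (P'' n t) t :=
  (Polynomial.derivative (legendre n)).hasDerivAt t

/-- A curve on the unit sphere with prescribed starting point and velocity. -/
lemma exists_sphere_curve {ξ v : E3} (hξ : ‖ξ‖ = 1) (hv : inner ℝ ξ v = 0) :
    ∃ γ : ℝ → E3, γ 0 = ξ ∧ HasDerivAt γ v 0 ∧ ∀ a, ‖γ a‖ = 1 := by
  have hpos : ∀ a : ℝ, 0 < 1 + a ^ 2 * ‖v‖ ^ 2 := fun a => by positivity
  refine ⟨fun a => (Real.sqrt (1 + a ^ 2 * ‖v‖ ^ 2))⁻¹ • (ξ + a • v), by simp, ?_, ?_⟩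
  · have h1 : HasDerivAt (fun a : ℝ => 1 + a ^ 2 * ‖v‖ ^ 2) 0 0 := by
      simpa using (((hasDerivAt_id (0 : ℝ)).fun_pow 2).mul_const (‖v‖ ^ 2)).const_add 1
    have h2 := (h1.sqrt (hpos 0).ne').fun_inv (Real.sqrt_pos.2 (hpos 0)).ne'
    have h3 : HasDerivAt (fun a : ℝ => ξ + a • v) v 0 := by
      simpa using ((hasDerivAt_id (0 : ℝ)).smul_const v).const_add ξ
    simpa using h2.fun_smul h3
  · intro a
    have hsq : ‖ξ + a • v‖ ^ 2 = 1 + a ^ 2 * ‖v‖ ^ 2 := by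
      rw [norm_add_sq_real, inner_smul_right, hv, norm_smul, hξ, Real.norm_eq_abs, mul_pow, sq_abs]
      ring
    rw [norm_smul, norm_inv, Real.norm_of_nonneg (Real.sqrt_nonneg _), ← hsq,
      Real.sqrt_sq (norm_nonneg _), inv_mul_cancel₀]
    intro h
    rw [h] at hsq
    have := hpos a
    rw [← hsq] at this
    simp at this

lemma hasDerivAt_polyFun_curve (p : MvPolynomial (Fin 3) ℝ) {γ : ℝ → E3} {v : E3} {a : ℝ}
    (h : HasDerivAt γ v a) :
    HasDerivAt (fun s => polyFun p (γ s)) (fderiv ℝ (polyFun p) (γ a) v) a :=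
  ((differentiable_polyFun p) (γ a)).hasFDerivAt.comp_hasDerivAt a h

/-- The addition theorem holds only for unit vectors, so it is differentiated along a curve on the
sphere with velocity `w`. -/
lemma sum_polyFun_mul_fderiv (hY : IsSphericalHarmonics Y) (n : ℕ) {x η w : E3} (hx : ‖x‖ = 1)
    (hη : ‖η‖ = 1) (hw : inner ℝ η w = 0) :
    ∑ k, polyFun (Y n k) x * fderiv ℝ (polyFun (Y n k)) η w
      = (2 * n + 1) / (4 * Real.pi) * (P' n (inner ℝ x η) * inner ℝ x w) := by
  obtain ⟨γ, hγ0, hγ, hγn⟩ := exists_sphere_curve hη hw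
  have h1 : HasDerivAt (fun b => repKernel Y n x (γ b))
      (∑ k, polyFun (Y n k) x * fderiv ℝ (polyFun (Y n k)) η w) 0 := by
    unfold repKernel
    refine HasDerivAt.fun_sum fun k _ => ?_
    have := (hasDerivAt_polyFun_curve (Y n k) hγ).const_mul (polyFun (Y n k) x)
    rwa [hγ0] at this
  have h2 : HasDerivAt (fun b => inner ℝ x (γ b)) (inner ℝ x w) 0 := by
    simpa using (hasDerivAt_const (0 : ℝ) x).inner ℝ hγ
  have h3 : HasDerivAt (fun b => (2 * n + 1) / (4 * Real.pi) * P n (inner ℝ x (γ b)))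
      ((2 * n + 1) / (4 * Real.pi) * (P' n (inner ℝ x η) * inner ℝ x w)) 0 := by
    have h4 := hasDerivAt_P n (inner ℝ x (γ 0))
    have := (HasDerivAt.comp (0 : ℝ) h4 h2).const_mul ((2 * n + 1) / (4 * Real.pi))
    rwa [hγ0] at this
  have h5 : (fun b => repKernel Y n x (γ b))
      = fun b => (2 * n + 1) / (4 * Real.pi) * P n (inner ℝ x (γ b)) := by
    ext b
    exact addition_theorem hY n hx (hγn b)
  rw [h5] at h1
  exact h1.unique h3

/-- `sum_polyFun_mul_fderiv` is differentiated once more, now in the first argument; the product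
rule produces the `P''` and `P'` terms. -/
lemma sum_fderiv_mul_fderiv (hY : IsSphericalHarmonics Y) (n : ℕ) {ξ η v w : E3} (hξ : ‖ξ‖ = 1)
    (hη : ‖η‖ = 1) (hv : inner ℝ ξ v = 0) (hw : inner ℝ η w = 0) :
    ∑ k, fderiv ℝ (polyFun (Y n k)) ξ v * fderiv ℝ (polyFun (Y n k)) η w
      = (2 * n + 1) / (4 * Real.pi) * (P'' n (inner ℝ ξ η) * inner ℝ v η * inner ℝ ξ w
        + P' n (inner ℝ ξ η) * inner ℝ v w) := by
  obtain ⟨γ, hγ0, hγ, hγn⟩ := exists_sphere_curve hξ hv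
  have h1 : HasDerivAt
      (fun a => ∑ k, polyFun (Y n k) (γ a) * fderiv ℝ (polyFun (Y n k)) η w)
      (∑ k, fderiv ℝ (polyFun (Y n k)) ξ v * fderiv ℝ (polyFun (Y n k)) η w) 0 := by
    refine HasDerivAt.fun_sum fun k _ => ?_
    have := (hasDerivAt_polyFun_curve (Y n k) hγ).mul_const (fderiv ℝ (polyFun (Y n k)) η w)
    rwa [hγ0] at this
  have h2 : ∀ z : E3, HasDerivAt (fun a => inner ℝ (γ a) z) (inner ℝ v z) 0 := fun z => by
    simpa using hγ.inner ℝ (hasDerivAt_const (0 : ℝ) z)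
  have h3 : HasDerivAt (fun a => (2 * n + 1) / (4 * Real.pi)
        * (P' n (inner ℝ (γ a) η) * inner ℝ (γ a) w))
      ((2 * n + 1) / (4 * Real.pi) * (P'' n (inner ℝ ξ η) * inner ℝ v η * inner ℝ ξ w
        + P' n (inner ℝ ξ η) * inner ℝ v w)) 0 := by
    have h4 := HasDerivAt.comp (0 : ℝ) (hasDerivAt_P' n (inner ℝ (γ 0) η)) (h2 η)
    have := (h4.fun_mul (h2 w)).const_mul ((2 * n + 1) / (4 * Real.pi))
    rw [hγ0] at this
    simpa [hγ0] using this
  have h5 : (fun a => ∑ k, polyFun (Y n k) (γ a) * fderiv ℝ (polyFun (Y n k)) η w)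
      = fun a => (2 * n + 1) / (4 * Real.pi) * (P' n (inner ℝ (γ a) η) * inner ℝ (γ a) w) := by
    ext a
    exact sum_polyFun_mul_fderiv hY n (hγn a) hη hw
  rw [h5] at h1
  exact h1.unique h3

lemma inner_surfaceGradient (F : E3 → ℝ) (ξ u : E3) :
    inner ℝ (surfaceGradient F ξ) u = fderiv ℝ F ξ (u - inner ℝ ξ u • ξ) := by
  have h : ∀ v, fderiv ℝ F ξ v = inner ℝ (gradient F ξ) v := fun v => by
    rw [gradient, InnerProductSpace.toDual_symm_apply]
  rw [h, surfaceGradient, inner_sub_left, inner_sub_right, inner_smul_left, inner_smul_right,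
    real_inner_comm ξ (gradient F ξ)]
  simp
  ring

/-- The addition theorem for vector spherical harmonics of the second type. -/
theorem tangential_addition_theorem (hY : IsSphericalHarmonics Y) (n : ℕ) {ξ η : E3}
    (hξ : ‖ξ‖ = 1) (hη : ‖η‖ = 1) (u w : E3) :
    ∑ k, inner ℝ (surfaceGradient (polyFun (Y n k)) ξ) u
        * inner ℝ (surfaceGradient (polyFun (Y n k)) η) w
      = (2 * n + 1) / (4 * Real.pi) *
        (P'' n (inner ℝ ξ η) * (inner ℝ η u - inner ℝ ξ η * inner ℝ ξ u)
            * (inner ℝ ξ w - inner ℝ ξ η * inner ℝ η w)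
        + P' n (inner ℝ ξ η) * (inner ℝ u w - inner ℝ ξ u * inner ℝ ξ w
            - inner ℝ η u * inner ℝ η w + inner ℝ ξ η * inner ℝ ξ u * inner ℝ η w)) := by
  simp only [inner_surfaceGradient]
  have hξ2 : inner ℝ ξ ξ = 1 := by rw [real_inner_self_eq_norm_sq, hξ, one_pow]
  have hη2 : inner ℝ η η = 1 := by rw [real_inner_self_eq_norm_sq, hη, one_pow]
  rw [sum_fderiv_mul_fderiv hY n hξ hη
    (by rw [inner_sub_right, inner_smul_right, hξ2, mul_one, sub_self])
    (by rw [inner_sub_right, inner_smul_right, hη2, mul_one, sub_self])]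
  simp only [inner_sub_left, inner_sub_right, inner_smul_left, inner_smul_right, conj_trivial,
    real_inner_comm η u]
  rw [real_inner_comm u η]
  ring

/-- The tangential coefficient of a kernel belonging to the first derivatives. -/
def tangentA (N : ℕ) (s : ℕ → ℝ) (t : ℝ) : ℝ :=
  ∑ n ∈ Finset.range (N + 1), s n * ((2 * n + 1) / (n * (n + 1))) * P' n t

/-- The tangential coefficient of a kernel belonging to the second derivatives. -/
def tangentB (N : ℕ) (s : ℕ → ℝ) (t : ℝ) : ℝ :=
  ∑ n ∈ Finset.range (N + 1), s n * ((2 * n + 1) / (n * (n + 1))) * P'' n t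

/-- The radial coefficient of a kernel. -/
def radialF (N : ℕ) (s : ℕ → ℝ) (t : ℝ) : ℝ :=
  ∑ n ∈ Finset.range (N + 1), s n * (2 * n + 1) * P n t

lemma radialF_eq (hY : IsSphericalHarmonics Y) (N : ℕ) (s : ℕ → ℝ) {ξ η : E3}
    (hξ : ‖ξ‖ = 1) (hη : ‖η‖ = 1) :
    radialF N s (inner ℝ ξ η)
      = 4 * Real.pi * ∑ n ∈ Finset.range (N + 1), s n * repKernel Y n ξ η := by
  rw [radialF, Finset.mul_sum]
  refine Finset.sum_congr rfl fun n _ => ?_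
  rw [addition_theorem hY n hξ hη]
  field_simp

lemma apply_eq_inner_single (v : E3) (i : Fin 3) : v i = inner ℝ v (EuclideanSpace.single i 1) := by
  simp [EuclideanSpace.inner_single_right]

/-- The entries of a bandlimited tensorial kernel. -/
lemma kernelOf_apply (hY : IsSphericalHarmonics Y) {a b : ℝ} (ha : 0 < a) (hb : 0 < b) (N : ℕ)
    (s : ℕ → ℝ) (x : Sph a) (y : Sph b) {ξ η : E3} (hx : (1 / ‖(x : E3)‖) • (x : E3) = ξ)
    (hy : (1 / ‖(y : E3)‖) • (y : E3) = η) (hξ : ‖ξ‖ = 1) (hη : ‖η‖ = 1) (i j : Fin 3) :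
    kernelOf Y a b N s x y i j = 1 / (4 * Real.pi * a * b) *
      (radialF N s (inner ℝ ξ η) * (ξ i * η j)
      + tangentB N s (inner ℝ ξ η) * ((η i - inner ℝ ξ η * ξ i) * (ξ j - inner ℝ ξ η * η j))
      + tangentA N s (inner ℝ ξ η) * ((if i = j then 1 else 0) - ξ i * ξ j - η i * η j
          + inner ℝ ξ η * ξ i * η j)) := by
  have hpi : Real.pi ≠ 0 := Real.pi_ne_zero
  have h1 : ∀ n, ∑ k : Fin (2 * n + 1),
      (s n • tensor ((1 / a) • vectorHarmonic 0 n (Y n k) ξ)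
        ((1 / b) • vectorHarmonic 0 n (Y n k) η)) i j
      = 1 / (4 * Real.pi * a * b) * (s n * (2 * n + 1) * P n (inner ℝ ξ η)) * (ξ i * η j) := by
    intro n
    have e : ∀ k, (s n • tensor ((1 / a) • vectorHarmonic 0 n (Y n k) ξ)
        ((1 / b) • vectorHarmonic 0 n (Y n k) η)) i j
        = s n * (1 / a) * (1 / b) * (ξ i * η j) * (polyFun (Y n k) ξ * polyFun (Y n k) η) := by
      intro k
      simp [tensor, vectorHarmonic, Matrix.vecMulVec_apply]
      ring
    simp only [e, ← Finset.mul_sum]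
    have := addition_theorem hY n hξ hη
    rw [repKernel] at this
    rw [this]
    field_simp
  have h2 : ∀ n, ∑ k : Fin (2 * n + 1),
      (s n • tensor ((1 / a) • vectorHarmonic 1 n (Y n k) ξ)
        ((1 / b) • vectorHarmonic 1 n (Y n k) η)) i j
      = 1 / (4 * Real.pi * a * b) *
        (s n * ((2 * n + 1) / (n * (n + 1))) * P'' n (inner ℝ ξ η)
            * ((η i - inner ℝ ξ η * ξ i) * (ξ j - inner ℝ ξ η * η j))
          + s n * ((2 * n + 1) / (n * (n + 1))) * P' n (inner ℝ ξ η)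
            * ((if i = j then 1 else 0) - ξ i * ξ j - η i * η j
          + inner ℝ ξ η * ξ i * η j)) := by
    intro n
    have hsq : (1 / Real.sqrt ((n : ℝ) * ((n : ℝ) + 1))) * (1 / Real.sqrt ((n : ℝ) * ((n : ℝ) + 1)))
        = 1 / (n * (n + 1)) := by
      rw [div_mul_div_comm, one_mul, Real.mul_self_sqrt (by positivity)]
    have e : ∀ k, (s n • tensor ((1 / a) • vectorHarmonic 1 n (Y n k) ξ)
        ((1 / b) • vectorHarmonic 1 n (Y n k) η)) i j
        = s n * (1 / a) * (1 / b) * (1 / (n * (n + 1))) *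
          (inner ℝ (surfaceGradient (polyFun (Y n k)) ξ) (EuclideanSpace.single i 1)
          * inner ℝ (surfaceGradient (polyFun (Y n k)) η) (EuclideanSpace.single j 1)) := by
      intro k
      rw [← hsq, ← apply_eq_inner_single, ← apply_eq_inner_single]
      simp only [tensor, vectorHarmonic, Matrix.smul_apply, Matrix.vecMulVec_apply, smul_eq_mul,
        PiLp.smul_apply, if_neg (show (1 : Fin 2) ≠ 0 by decide)]
      ring
    simp only [e, ← Finset.mul_sum]
    rw [tangential_addition_theorem hY n hξ hη]
    have hij : inner ℝ (EuclideanSpace.single i (1 : ℝ)) (EuclideanSpace.single j (1 : ℝ) : E3)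
        = if i = j then (1 : ℝ) else 0 := by
      rw [← apply_eq_inner_single]
      simp [eq_comm]
    rw [hij]
    simp only [← apply_eq_inner_single]
    rcases Nat.eq_zero_or_pos n with rfl | hn
    · simp
    · have : (n : ℝ) ≠ 0 := by positivity
      field_simp
  have h3 : Finset.Icc 0 N = Finset.range (N + 1) := by ext; simp
  -- The type 2 sum may start at `0`: the extra summand carries the factor `1 / 0 = 0`.
  have h4 : ∀ g : ℕ → ℝ, g 0 = 0 →
      ∑ n ∈ Finset.Icc 1 N, g n = ∑ n ∈ Finset.range (N + 1), g n := by
    intro g hg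
    refine Finset.sum_subset (fun n hn => ?_) (fun n hn hn' => ?_)
    · simp at hn ⊢; omega
    · simp at hn hn'
      rw [show n = 0 by omega, hg]
  unfold kernelOf
  rw [hx, hy]
  simp only [Matrix.sum_apply, Fin.sum_univ_two, h1, h2]
  rw [Fin.val_zero, Fin.val_one, h3, h4 _ (by simp), radialF, tangentA, tangentB]
  simp only [Finset.sum_mul, Finset.mul_sum, mul_add, Finset.sum_add_distrib, mul_assoc, add_assoc]

end

/-! ### The Frobenius norm of a kernel and the Gram entries. -/

section
open MvPolynomial MeasureTheory

variable {Y : (n : ℕ) → Fin (2 * n + 1) → MvPolynomial (Fin 3) ℝ}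

/-- The squared Frobenius norm of a kernel, up to a constant factor. -/
def density (N : ℕ) (s : ℕ → ℝ) (t : ℝ) : ℝ :=
  radialF N s t ^ 2 + (1 - t ^ 2) ^ 2 * tangentB N s t ^ 2
    - 2 * t * (1 - t ^ 2) * (tangentA N s t * tangentB N s t)
    + (1 + t ^ 2) * tangentA N s t ^ 2

lemma sum_sq_tensor_combination (a b c d e : ℝ) (ξ η : Fin 3 → ℝ) :
    ∑ i, ∑ j, (a * (if i = j then 1 else 0) + b * (ξ i * ξ j) + c * (η i * η j)
        + d * (ξ i * η j) + e * (η i * ξ j)) ^ 2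
      = 3 * a ^ 2 + b ^ 2 * (∑ i, ξ i ^ 2) ^ 2 + c ^ 2 * (∑ i, η i ^ 2) ^ 2
        + (d ^ 2 + e ^ 2) * ((∑ i, ξ i ^ 2) * ∑ i, η i ^ 2)
        + 2 * a * b * (∑ i, ξ i ^ 2) + 2 * a * c * (∑ i, η i ^ 2)
        + 2 * a * (d + e) * (∑ i, ξ i * η i) + 2 * (b * c + d * e) * (∑ i, ξ i * η i) ^ 2
        + 2 * b * (d + e) * ((∑ i, ξ i ^ 2) * ∑ i, ξ i * η i)
        + 2 * c * (d + e) * ((∑ i, η i ^ 2) * ∑ i, ξ i * η i) := by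
  simp [Fin.sum_univ_three]
  ring

lemma sum_sq_eq_one {ξ : E3} (hξ : ‖ξ‖ = 1) : ∑ i, ξ i ^ 2 = 1 := by
  rw [EuclideanSpace.norm_eq, Real.sqrt_eq_one] at hξ
  simpa using hξ

lemma inner_eq_sum (ξ η : E3) : inner ℝ ξ η = ∑ i, ξ i * η i := by
  simp [PiLp.inner_apply, mul_comm]

/-- The squared Frobenius norm of a bandlimited tensorial kernel. -/
lemma sum_sq_kernelOf (hY : IsSphericalHarmonics Y) {a b : ℝ} (ha : 0 < a) (hb : 0 < b) (N : ℕ)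
    (s : ℕ → ℝ) (x : Sph a) (y : Sph b) {ξ η : E3} (hx : (1 / ‖(x : E3)‖) • (x : E3) = ξ)
    (hy : (1 / ‖(y : E3)‖) • (y : E3) = η) (hξ : ‖ξ‖ = 1) (hη : ‖η‖ = 1) :
    ∑ i, ∑ j, kernelOf Y a b N s x y i j ^ 2
      = (1 / (4 * Real.pi * a * b)) ^ 2 * density N s (inner ℝ ξ η) := by
  simp only [kernelOf_apply hY ha hb N s x y hx hy hξ hη, mul_pow, ← Finset.mul_sum]
  congr 1
  set t := inner ℝ ξ η with ht
  -- These are the coefficients of the identity, `ξ⊗ξ`, `η⊗η`, `ξ⊗η` and `η⊗ξ` after expanding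
  -- `kernelOf_apply`.
  have h := sum_sq_tensor_combination (tangentA N s t) (-tangentA N s t - t * tangentB N s t)
    (-tangentA N s t - t * tangentB N s t)
    (radialF N s t + t ^ 2 * tangentB N s t + t * tangentA N s t) (tangentB N s t) ξ η
  rw [sum_sq_eq_one hξ, sum_sq_eq_one hη, ← inner_eq_sum, ← ht] at h
  rw [density]
  refine Eq.trans (Finset.sum_congr rfl fun i _ => Finset.sum_congr rfl fun j _ => ?_)
    (h.trans ?_)
  · ring
  · ring

lemma norm_normalize {a : ℝ} (ha : 0 < a) (x : Sph a) : ‖(1 / ‖(x : E3)‖) • (x : E3)‖ = 1 := by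
  have hx : ‖(x : E3)‖ = a := mem_sphere_zero_iff_norm.1 x.2
  rw [norm_smul, hx, norm_div, norm_one, Real.norm_of_nonneg ha.le, one_div,
    inv_mul_cancel₀ ha.ne']

lemma exists_sphere_normalize {a : ℝ} (ha : 0 < a) {ξ : E3} (hξ : ‖ξ‖ = 1) :
    ∃ x : Sph a, (1 / ‖(x : E3)‖) • (x : E3) = ξ := by
  have hn : ‖a • ξ‖ = a := by rw [norm_smul, hξ, mul_one, Real.norm_of_nonneg ha.le]
  refine ⟨⟨a • ξ, mem_sphere_zero_iff_norm.2 hn⟩, ?_⟩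
  simp only
  rw [hn, smul_smul, one_div, inv_mul_cancel₀ ha.ne', one_smul]

lemma exists_inner_eq {t : ℝ} (h1 : -1 ≤ t) (h2 : t ≤ 1) :
    ∃ ξ η : E3, ‖ξ‖ = 1 ∧ ‖η‖ = 1 ∧ inner ℝ ξ η = t := by
  refine ⟨EuclideanSpace.single 0 1, !₂[t, Real.sqrt (1 - t ^ 2), 0], by simp, ?_, ?_⟩
  · rw [EuclideanSpace.norm_eq, Real.sqrt_eq_one]
    simp [Fin.sum_univ_three, Real.sq_sqrt (show 0 ≤ 1 - t ^ 2 by nlinarith)]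
  · simp [EuclideanSpace.inner_single_left]

/-- The set in `profile` is a singleton: the Frobenius norm depends only on `t`, and every `t` in
`[-1,1]` is attained. -/
lemma profile_kernelOf_sq (hY : IsSphericalHarmonics Y) {a : ℝ} (ha : 0 < a) (N : ℕ)
    (s : ℕ → ℝ) {t : ℝ} (h1 : -1 ≤ t) (h2 : t ≤ 1) :
    profile (kernelOf Y a a N s) t ^ 2 = (1 / (4 * Real.pi * a * a)) ^ 2 * density N s t := by
  obtain ⟨ξ, η, hξ, hη, ht⟩ := exists_inner_eq h1 h2
  obtain ⟨x, hx⟩ := exists_sphere_normalize ha hξ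
  obtain ⟨y, hy⟩ := exists_sphere_normalize ha hη
  have habs : ∀ x y : Sph a,
      inner ℝ ((1 / ‖(x : E3)‖) • (x : E3)) ((1 / ‖(y : E3)‖) • (y : E3)) = t →
      tensorAbs (kernelOf Y a a N s x y)
        = Real.sqrt ((1 / (4 * Real.pi * a * a)) ^ 2 * density N s t) := by
    intro x y h
    rw [tensorAbs, sum_sq_kernelOf hY ha ha N s x y rfl rfl (norm_normalize ha x)
      (norm_normalize ha y), h]
  have hset : {c : ℝ | ∃ x y : Sph a,
      inner ℝ ((1 / ‖(x : E3)‖) • (x : E3)) ((1 / ‖(y : E3)‖) • (y : E3)) = t ∧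
        c = tensorAbs (kernelOf Y a a N s x y)}
      = {Real.sqrt ((1 / (4 * Real.pi * a * a)) ^ 2 * density N s t)} := by
    ext c
    simp only [Set.mem_ofPred_eq, Set.mem_singleton_iff]
    constructor
    · rintro ⟨x, y, h, rfl⟩
      exact habs x y h
    · rintro rfl
      have hxy : inner ℝ ((1 / ‖(x : E3)‖) • (x : E3)) ((1 / ‖(y : E3)‖) • (y : E3)) = t := by
        rw [hx, hy, ht]
      exact ⟨x, y, hxy, (habs x y hxy).symm⟩
  have hnn : 0 ≤ (1 / (4 * Real.pi * a * a)) ^ 2 * density N s t := by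
    rw [← ht, ← sum_sq_kernelOf hY ha ha N s x y hx hy hξ hη]
    exact Finset.sum_nonneg fun i _ => Finset.sum_nonneg fun j _ => sq_nonneg _
  rw [profile, hset, csSup_singleton, Real.sq_sqrt hnn]

lemma continuous_P (n : ℕ) : Continuous (P n) := (legendre n).continuous
lemma continuous_P' (n : ℕ) : Continuous (P' n) := (Polynomial.derivative (legendre n)).continuous
lemma continuous_P'' (n : ℕ) : Continuous (P'' n) :=
  (Polynomial.derivative (Polynomial.derivative (legendre n))).continuous

/-- The integrand of the Gram entries. -/
def gramDensity (n m : ℕ) (t : ℝ) : ℝ :=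
  (2 * n + 1) * (2 * m + 1) / 2 * (P n t * P m t)
    + (2 * n + 1) * (2 * m + 1) / (2 * n * (n + 1) * m * (m + 1)) *
      ((1 + t ^ 2) * P' n t * P' m t + (1 - t ^ 2) ^ 2 * P'' n t * P'' m t
        - t * (1 - t ^ 2) * P'' n t * P' m t - t * (1 - t ^ 2) * P' n t * P'' m t)

lemma continuous_gramDensity (n m : ℕ) : Continuous (gramDensity n m) := by
  have := continuous_P n
  have := continuous_P m
  have := continuous_P' n
  have := continuous_P' m
  have := continuous_P'' n
  have := continuous_P'' m
  unfold gramDensity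
  fun_prop

lemma integral_linear_combination {f₀ f₁ f₂ f₃ f₄ : ℝ → ℝ} (h₀ : Continuous f₀)
    (h₁ : Continuous f₁) (h₂ : Continuous f₂) (h₃ : Continuous f₃) (h₄ : Continuous f₄)
    (a b c d : ℝ) :
    c * (∫ t in a..b, f₀ t) + d * ((∫ t in a..b, f₁ t) + (∫ t in a..b, f₂ t)
        - (∫ t in a..b, f₃ t) - (∫ t in a..b, f₄ t))
      = ∫ t in a..b, (c * f₀ t + d * (f₁ t + f₂ t - f₃ t - f₄ t)) := by
  have hi : ∀ f : ℝ → ℝ, Continuous f → IntervalIntegrable f volume a b :=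
    fun f hf => hf.intervalIntegrable _ _
  rw [intervalIntegral.integral_add (hi _ (by fun_prop)) (hi _ (by fun_prop)),
    intervalIntegral.integral_const_mul, intervalIntegral.integral_const_mul,
    intervalIntegral.integral_sub (hi _ (by fun_prop)) (hi _ (by fun_prop)),
    intervalIntegral.integral_sub (hi _ (by fun_prop)) (hi _ (by fun_prop)),
    intervalIntegral.integral_add (hi _ (by fun_prop)) (hi _ (by fun_prop))]

/-- One formula covers both cases of `gram`: for `n = 0` or `m = 0` the second prefactor has
denominator zero and hence vanishes. -/
lemma gram_eq_integral (ρ : ℝ) (n m : ℕ) :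
    gram ρ n m = ∫ t in (-1 : ℝ)..(1 - ρ), gramDensity n m t := by
  have huni : gram ρ n m =
    (2 * n + 1) * (2 * m + 1) / 2 * (∫ t in (-1 : ℝ)..(1 - ρ), P n t * P m t)
      + (2 * n + 1) * (2 * m + 1) / (2 * n * (n + 1) * m * (m + 1)) *
        ((∫ t in (-1 : ℝ)..(1 - ρ), (1 + t ^ 2) * P' n t * P' m t)
          + (∫ t in (-1 : ℝ)..(1 - ρ), (1 - t ^ 2) ^ 2 * P'' n t * P'' m t)
          - (∫ t in (-1 : ℝ)..(1 - ρ), t * (1 - t ^ 2) * P'' n t * P' m t)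
          - (∫ t in (-1 : ℝ)..(1 - ρ), t * (1 - t ^ 2) * P' n t * P'' m t)) := by
    unfold gram
    split_ifs with h
    · rcases h with rfl | rfl <;> simp
    · rfl
  have c0 : Continuous fun t => P n t * P m t :=
    (continuous_P n).mul (continuous_P m)
  have c1 : Continuous fun t => (1 + t ^ 2) * P' n t * P' m t :=
    ((continuous_const.add (continuous_id.pow 2)).mul (continuous_P' n)).mul (continuous_P' m)
  have c2 : Continuous fun t => (1 - t ^ 2) ^ 2 * P'' n t * P'' m t :=
    (((continuous_const.sub (continuous_id.pow 2)).pow 2).mul (continuous_P'' n)).mul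
      (continuous_P'' m)
  have c3 : Continuous fun t => t * (1 - t ^ 2) * P'' n t * P' m t :=
    ((continuous_id.mul (continuous_const.sub (continuous_id.pow 2))).mul (continuous_P'' n)).mul
      (continuous_P' m)
  have c4 : Continuous fun t => t * (1 - t ^ 2) * P' n t * P'' m t :=
    ((continuous_id.mul (continuous_const.sub (continuous_id.pow 2))).mul (continuous_P' n)).mul
      (continuous_P'' m)
  rw [huni, integral_linear_combination c0 c1 c2 c3 c4]
  rfl

lemma gram_symm (ρ : ℝ) (n m : ℕ) : gram ρ n m = gram ρ m n := by
  rw [gram_eq_integral, gram_eq_integral]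
  congr 1
  ext t
  unfold gramDensity
  ring

/-- Every term of `gramDensity` is, for fixed `t`, a factor in `n` times a factor in `m`, so the
double sums split into products of `radialF`, `tangentA` and `tangentB`. -/
lemma sum_sum_gramDensity (N : ℕ) (s : ℕ → ℝ) (t : ℝ) :
    ∑ n ∈ Finset.range (N + 1), ∑ m ∈ Finset.range (N + 1), s n * s m * gramDensity n m t
      = 1 / 2 * density N s t := by
  have h : ∀ n m : ℕ, s n * s m * gramDensity n m t =
      1 / 2 * ((s n * (2 * n + 1) * P n t) * (s m * (2 * m + 1) * P m t))
      + (1 + t ^ 2) / 2 * ((s n * ((2 * n + 1) / (n * (n + 1))) * P' n t)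
          * (s m * ((2 * m + 1) / (m * (m + 1))) * P' m t))
      + (1 - t ^ 2) ^ 2 / 2 * ((s n * ((2 * n + 1) / (n * (n + 1))) * P'' n t)
          * (s m * ((2 * m + 1) / (m * (m + 1))) * P'' m t))
      + -(t * (1 - t ^ 2) / 2) * ((s n * ((2 * n + 1) / (n * (n + 1))) * P'' n t)
          * (s m * ((2 * m + 1) / (m * (m + 1))) * P' m t))
      + -(t * (1 - t ^ 2) / 2) * ((s n * ((2 * n + 1) / (n * (n + 1))) * P' n t)
          * (s m * ((2 * m + 1) / (m * (m + 1))) * P'' m t)) := by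
    intro n m
    have e : ((2 * n + 1) * (2 * m + 1) / (2 * n * (n + 1) * m * (m + 1)) : ℝ)
        = 1 / 2 * ((2 * n + 1) / (n * (n + 1)) * ((2 * m + 1) / (m * (m + 1)))) := by
      rw [div_mul_div_comm, div_mul_div_comm, one_mul]
      congr 1
      ring
    rw [gramDensity, e]
    ring
  simp only [h, Finset.sum_add_distrib, ← Finset.mul_sum, ← Finset.sum_mul]
  rw [density, radialF, tangentA, tangentB]
  ring

/-- The constants match because `8π²a⁴ (1/(4πa²))² = 1/2`. The identity gives both the Gram blocks
of the system and their nonnegativity. -/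
lemma zonalNorm_kernelOf_sq (hY : IsSphericalHarmonics Y) {a : ℝ} (ha : 0 < a) {ρ : ℝ}
    (hρ : 0 ≤ ρ) (hρ2 : ρ ≤ 2) (N : ℕ) (s : ℕ → ℝ) :
    8 * Real.pi ^ 2 * a ^ 4 * zonalNorm ρ (kernelOf Y a a N s) ^ 2
      = ∑ n ∈ Finset.range (N + 1), ∑ m ∈ Finset.range (N + 1), s n * s m * gram ρ n m := by
  have hle : (-1 : ℝ) ≤ 1 - ρ := by linarith
  have h1 : ∫ t in (-1 : ℝ)..(1 - ρ), profile (kernelOf Y a a N s) t ^ 2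
      = ∫ t in (-1 : ℝ)..(1 - ρ), (1 / (4 * Real.pi * a * a)) ^ 2 * density N s t := by
    apply intervalIntegral.integral_congr
    intro t ht
    rw [Set.uIcc_of_le hle] at ht
    exact profile_kernelOf_sq hY ha N s ht.1 (by linarith [ht.2])
  have h2 : 0 ≤ ∫ t in (-1 : ℝ)..(1 - ρ), profile (kernelOf Y a a N s) t ^ 2 :=
    intervalIntegral.integral_nonneg hle fun t _ => sq_nonneg _
  have h3 : ∫ t in (-1 : ℝ)..(1 - ρ), 1 / 2 * density N s t
      = ∑ n ∈ Finset.range (N + 1), ∑ m ∈ Finset.range (N + 1), s n * s m * gram ρ n m := by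
    simp only [← sum_sum_gramDensity]
    have hc : ∀ n m, Continuous fun t => s n * s m * gramDensity n m t := fun n m =>
      continuous_const.mul (continuous_gramDensity n m)
    rw [intervalIntegral.integral_finsetSum fun n _ =>
      (continuous_finsetSum _ fun m _ => hc n m).intervalIntegrable _ _]
    refine Finset.sum_congr rfl fun n _ => ?_
    rw [intervalIntegral.integral_finsetSum fun m _ => (hc n m).intervalIntegrable _ _]
    refine Finset.sum_congr rfl fun m _ => ?_
    rw [intervalIntegral.integral_const_mul, gram_eq_integral]
  rw [zonalNorm, Real.sq_sqrt h2, h1, ← h3, intervalIntegral.integral_const_mul,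
    intervalIntegral.integral_const_mul]
  have hpi := Real.pi_ne_zero
  field_simp
  ring

end

/-! ### Uniqueness of symbols. -/

section
open MvPolynomial MeasureTheory

variable {Y : (n : ℕ) → Fin (2 * n + 1) → MvPolynomial (Fin 3) ℝ}

/-- The purely radial component of a kernel. -/
lemma sum_radial_kernelOf (hY : IsSphericalHarmonics Y) {a b : ℝ} (ha : 0 < a) (hb : 0 < b) (N : ℕ)
    (s : ℕ → ℝ) (x : Sph a) (y : Sph b) {ξ η : E3} (hx : (1 / ‖(x : E3)‖) • (x : E3) = ξ)
    (hy : (1 / ‖(y : E3)‖) • (y : E3) = η) (hξ : ‖ξ‖ = 1) (hη : ‖η‖ = 1) :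
    a * b * ∑ i, ∑ j, ξ i * kernelOf Y a b N s x y i j * η j
      = ∑ n ∈ Finset.range (N + 1), s n * repKernel Y n ξ η := by
  have hF := radialF_eq hY N s hξ hη
  have h1 := sum_sq_eq_one hξ
  have h2 := sum_sq_eq_one hη
  have h3 := inner_eq_sum ξ η
  simp only [kernelOf_apply hY ha hb N s x y hx hy hξ hη]
  set t := inner ℝ ξ η
  set F := radialF N s t
  set A := tangentA N s t
  set B := tangentB N s t
  have key : ∑ i, ∑ j, ξ i * (1 / (4 * Real.pi * a * b) *
      (F * (ξ i * η j) + B * ((η i - t * ξ i) * (ξ j - t * η j))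
      + A * ((if i = j then 1 else 0) - ξ i * ξ j - η i * η j + t * ξ i * η j))) * η j
      = 1 / (4 * Real.pi * a * b) * (F * ((∑ i, ξ i ^ 2) * ∑ i, η i ^ 2)
        + B * (((∑ i, ξ i * η i) - t * ∑ i, ξ i ^ 2) * ((∑ i, ξ i * η i) - t * ∑ i, η i ^ 2))
        + A * ((∑ i, ξ i * η i) - (∑ i, ξ i ^ 2) * (∑ i, ξ i * η i)
          - (∑ i, ξ i * η i) * (∑ i, η i ^ 2) + t * ((∑ i, ξ i ^ 2) * ∑ i, η i ^ 2))) := by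
    simp [Fin.sum_univ_three]
    ring
  rw [key, h1, h2, ← h3, hF]
  have hpi := Real.pi_ne_zero
  field_simp
  ring

/-- As a function of `ξ` the sum is a polynomial in the `Y n k`, and orthonormality isolates the
degree `m`. -/
lemma integral_sum_repKernel_mul (hY : IsSphericalHarmonics Y) {N m : ℕ} (hm : m ≤ N) (s : ℕ → ℝ)
    (l : Fin (2 * m + 1)) (η : E3) :
    ∫ ξ : Sph 1, (∑ n ∈ Finset.range (N + 1), s n * repKernel Y n (ξ : E3) η)
      * polyFun (Y m l) (ξ : E3) ∂sphMeasure = s m * polyFun (Y m l) η := by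
  set p : MvPolynomial (Fin 3) ℝ :=
    ∑ n ∈ Finset.range (N + 1), s n • ∑ k, polyFun (Y n k) η • Y n k with hp
  have hpv : ∀ ξ, polyFun p ξ = ∑ n ∈ Finset.range (N + 1), s n * repKernel Y n ξ η := by
    intro ξ
    rw [hp, polyFun_sum]
    refine Finset.sum_congr rfl fun n _ => ?_
    rw [polyFun_smul, polyFun_sum, repKernel]
    congr 1
    exact Finset.sum_congr rfl fun k _ => by rw [polyFun_smul, mul_comm]
  simp only [← hpv]
  change sphForm p (Y m l) = _
  rw [hp, sphForm_sum_left, Finset.sum_eq_single m]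
  · rw [sphForm_sum_left]
    simp [hY.sphForm_same]
  · intro n _ hn
    rw [sphForm_sum_left]
    simp [hY.sphForm_of_ne hn]
  · intro h
    exact absurd (Finset.mem_range.2 (Nat.lt_succ_of_le hm)) h

/-- The symbols of a kernel are unique. -/
lemma eq_of_kernelOf_eq (hY : IsSphericalHarmonics Y) {a b : ℝ} (ha : 0 < a) (hb : 0 < b) {N : ℕ}
    {s s' : ℕ → ℝ} (h : kernelOf Y a b N s = kernelOf Y a b N s') {m : ℕ} (hm : m ≤ N) :
    s m = s' m := by
  have h1 : ∀ ξ η : E3, ‖ξ‖ = 1 → ‖η‖ = 1 →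
      ∑ n ∈ Finset.range (N + 1), s n * repKernel Y n ξ η
        = ∑ n ∈ Finset.range (N + 1), s' n * repKernel Y n ξ η := by
    intro ξ η hξ hη
    obtain ⟨x, hx⟩ := exists_sphere_normalize ha hξ
    obtain ⟨y, hy⟩ := exists_sphere_normalize hb hη
    rw [← sum_radial_kernelOf hY ha hb N s x y hx hy hξ hη,
      ← sum_radial_kernelOf hY ha hb N s' x y hx hy hξ hη, h]
  have h2 : ∀ η : Sph 1, s m * polyFun (Y m 0) (η : E3) = s' m * polyFun (Y m 0) (η : E3) := by
    intro η
    rw [← integral_sum_repKernel_mul hY hm, ← integral_sum_repKernel_mul hY hm]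
    congr 1
    ext ξ
    rw [h1 _ _ (by simp) (by simp)]
  -- `Y m 0` has norm one, so it cannot vanish on the whole sphere.
  have h3 := hY.sphForm_same m 0 0
  rw [if_pos rfl] at h3
  by_contra hne
  have h4 : ∀ η : Sph 1, polyFun (Y m 0) (η : E3) = 0 := by
    intro η
    have := h2 η
    rw [← sub_eq_zero, ← sub_mul] at this
    exact (mul_eq_zero.1 this).resolve_left (sub_ne_zero.2 hne)
  simp [sphForm, h4] at h3

lemma kernelOf_congr {a b : ℝ} {N : ℕ} {s s' : ℕ → ℝ} (h : ∀ n ≤ N, s n = s' n) :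
    kernelOf Y a b N s = kernelOf Y a b N s' := by
  funext x y
  unfold kernelOf
  refine Finset.sum_congr rfl fun i _ => Finset.sum_congr rfl fun n hn =>
    Finset.sum_congr rfl fun k _ => ?_
  rw [h n (Finset.mem_Icc.1 hn).2]

lemma hasSymbol_symbol {a b : ℝ} {N : ℕ} {K : Kernel a b} (hK : K ∈ Pol Y a b N) :
    HasSymbol Y a b N K (symbol Y a b N K) := by
  obtain ⟨s, rfl⟩ := hK
  have h : ∃ s' : ℕ → ℝ, HasSymbol Y a b N (kernelOf Y a b N s) s' :=
    ⟨fun n => if n ≤ N then s n else 0, fun n hn => if_neg (not_le.2 hn),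
      kernelOf_congr fun n hn => (if_pos hn).symm⟩
  rw [symbol, dif_pos h]
  exact Classical.choose_spec h

lemma symbol_kernelOf (hY : IsSphericalHarmonics Y) {a b : ℝ} (ha : 0 < a) (hb : 0 < b) {N : ℕ}
    (s : ℕ → ℝ) {n : ℕ} (hn : n ≤ N) : symbol Y a b N (kernelOf Y a b N s) n = s n :=
  (eq_of_kernelOf_eq hY ha hb (hasSymbol_symbol ⟨s, rfl⟩).2 hn).symm

/-! ### Minimizing a positive definite quadratic polynomial. -/

section Quadratic
open Matrix
variable {ι : Type*} [Fintype ι]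

/-- This completes the square at a solution `v`; symmetry of `A` merges the two cross terms. -/
lemma quadratic_expand {A : Matrix ι ι ℝ} (hA : A.transpose = A) {b v : ι → ℝ}
    (hv : A *ᵥ v = b) (w : ι → ℝ) :
    w ⬝ᵥ A *ᵥ w - 2 * (b ⬝ᵥ w)
      = (v ⬝ᵥ A *ᵥ v - 2 * (b ⬝ᵥ v)) + (w - v) ⬝ᵥ A *ᵥ (w - v) := by
  have h1 : v ⬝ᵥ A *ᵥ w = b ⬝ᵥ w := by
    rw [dotProduct_mulVec, ← mulVec_transpose, hA, hv]
  have h2 : w ⬝ᵥ A *ᵥ v = b ⬝ᵥ w := by rw [hv, dotProduct_comm]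
  have h3 : v ⬝ᵥ A *ᵥ v = b ⬝ᵥ v := by rw [hv, dotProduct_comm]
  rw [mulVec_sub, dotProduct_sub, sub_dotProduct, sub_dotProduct, h1, h2, h3]
  ring

lemma existsUnique_mulVec_eq {A : Matrix ι ι ℝ} (hpos : ∀ v, v ≠ 0 → 0 < v ⬝ᵥ A *ᵥ v)
    (b : ι → ℝ) : ∃! v, A *ᵥ v = b := by
  have hinj : Function.Injective A.mulVecLin := by
    rw [← LinearMap.ker_eq_bot, LinearMap.ker_eq_bot']
    intro v hv
    rw [Matrix.mulVecLin_apply] at hv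
    by_contra h
    have := hpos v h
    rw [hv, dotProduct_zero] at this
    exact lt_irrefl _ this
  have hsurj := LinearMap.injective_iff_surjective.1 hinj
  obtain ⟨v, hv⟩ := hsurj b
  exact ⟨v, hv, fun w hw => hinj (Eq.trans hw hv.symm)⟩

/-- No derivative is needed: a minimizer is compared with the solution, and definiteness of the
remainder forces them to agree. -/
lemma quadratic_minimizer_iff {A : Matrix ι ι ℝ} (hA : A.transpose = A)
    (hpos : ∀ v, v ≠ 0 → 0 < v ⬝ᵥ A *ᵥ v) (b v : ι → ℝ) :
    (∀ w, v ⬝ᵥ A *ᵥ v - 2 * (b ⬝ᵥ v) ≤ w ⬝ᵥ A *ᵥ w - 2 * (b ⬝ᵥ w)) ↔ A *ᵥ v = b := by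
  constructor
  · intro h
    obtain ⟨v₀, hv₀, -⟩ := existsUnique_mulVec_eq hpos b
    have h1 := h v₀
    rw [quadratic_expand hA hv₀ v] at h1
    by_cases hne : v - v₀ = 0
    · rwa [sub_eq_zero.1 hne]
    · have := hpos _ hne
      linarith
  · intro h w
    rw [quadratic_expand hA h w]
    by_cases hne : w - v = 0
    · simp [hne]
    · have := hpos _ hne
      linarith

end Quadratic

/-! ### The linear system and its correspondence with pairs of kernels. -/

section System
open Matrix

/-- The vector of two finite sequences. -/
def pairVector (N M : ℕ) (x y : ℕ → ℝ) : Fin (N + 1) ⊕ Fin (M + 1) → ℝ :=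
  Sum.elim (fun n => x n) (fun n => y n)

lemma exists_pairVector_eq {N M : ℕ} (v : Fin (N + 1) ⊕ Fin (M + 1) → ℝ) :
    ∃ x y : ℕ → ℝ, (∀ n, N < n → x n = 0) ∧ pairVector N M x y = v := by
  refine ⟨fun n => if h : n < N + 1 then v (Sum.inl ⟨n, h⟩) else 0,
    fun n => if h : n < M + 1 then v (Sum.inr ⟨n, h⟩) else 0,
    fun n hn => dif_neg (by omega), ?_⟩
  ext i
  rcases i with i | i
  · exact dif_pos i.2
  · exact dif_pos i.2

lemma sum_range_eq_of_support {N M : ℕ} (hNM : N ≤ M) {x : ℕ → ℝ} (hx : ∀ n, N < n → x n = 0) :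
    ∑ n ∈ Finset.range (M + 1), x n = ∑ n ∈ Finset.range (N + 1), x n := by
  symm
  refine Finset.sum_subset (Finset.range_subset_range.2 (by omega)) fun n _ hn => hx n ?_
  simpa [Nat.lt_succ_iff] using hn

/-- The quadratic form of the system matrix. -/
lemma dotProduct_systemMatrix_mulVec {r R ρ : ℝ} {N M : ℕ} (hNM : N ≤ M) (α' α : ℕ → ℝ) (β : ℝ)
    {x : ℕ → ℝ} (hx : ∀ n, N < n → x n = 0) (y : ℕ → ℝ) :
    pairVector N M x y ⬝ᵥ systemMatrix r R ρ N M α' α β *ᵥ pairVector N M x y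
      = ∑ n ∈ Finset.range (N + 1), (β / sigma r R n ^ 2 + α n) * x n ^ 2
        + ∑ n ∈ Finset.range (M + 1), α' n * y n ^ 2
        + ∑ n ∈ Finset.range (M + 1), ∑ m ∈ Finset.range (M + 1),
            (y n - x n) * (y m - x m) * gram ρ n m := by
  have e1 : ∑ n ∈ Finset.range (M + 1), ∑ m ∈ Finset.range (M + 1),
        (y n - x n) * (y m - x m) * gram ρ n m
      = ∑ n ∈ Finset.range (M + 1), ∑ m ∈ Finset.range (M + 1), y n * (gram ρ n m * y m)
        - ∑ n ∈ Finset.range (M + 1), ∑ m ∈ Finset.range (N + 1), y n * (gram ρ n m * x m)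
        - ∑ n ∈ Finset.range (N + 1), ∑ m ∈ Finset.range (M + 1), x n * (gram ρ n m * y m)
        + ∑ n ∈ Finset.range (N + 1), ∑ m ∈ Finset.range (N + 1), x n * (gram ρ n m * x m) := by
    -- As `x` vanishes beyond `N ≤ M`, blocks of different sizes can all be summed up to `M`.
    have c1 : ∀ z : ℕ → ℝ, ∑ m ∈ Finset.range (N + 1), ∑ n ∈ Finset.range (M + 1),
        x m * (gram ρ m n * z n)
        = ∑ m ∈ Finset.range (M + 1), ∑ n ∈ Finset.range (M + 1), x m * (gram ρ m n * z n) :=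
      fun z => (sum_range_eq_of_support hNM fun m hm => by simp [hx m hm]).symm
    have c2 : ∀ n : ℕ, ∀ c : ℝ, ∑ m ∈ Finset.range (N + 1), c * (gram ρ n m * x m)
        = ∑ m ∈ Finset.range (M + 1), c * (gram ρ n m * x m) :=
      fun n c => (sum_range_eq_of_support hNM fun m hm => by simp [hx m hm]).symm
    simp only [c2]
    rw [c1, c1]
    simp only [← Finset.sum_sub_distrib, ← Finset.sum_add_distrib]
    exact Finset.sum_congr rfl fun n _ => Finset.sum_congr rfl fun m _ => by ring
  obtain ⟨d, hd⟩ : ∃ d : ℕ → ℝ, ∀ n, β / sigma r R n ^ 2 + α n = d n := ⟨_, fun _ => rfl⟩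
  rw [e1, pairVector, systemMatrix]
  simp only [hd]
  rw [fromBlocks_mulVec, dotProduct, Fintype.sum_sum_type]
  simp only [Sum.elim_inl, Sum.elim_inr, Function.comp_def, Pi.add_apply, add_mulVec,
    mulVec_diagonal, neg_mulVec, Pi.neg_apply]
  simp only [mulVec, dotProduct, Matrix.of_apply]
  simp only [Finset.sum_range, mul_add, Finset.sum_add_distrib, mul_neg, Finset.sum_neg_distrib,
    Finset.mul_sum, Finset.sum_add_distrib]
  have d1 : ∀ i : Fin (N + 1), x i * (d i * x i) = d i * x i ^ 2 := fun i => by ring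
  have d2 : ∀ i : Fin (M + 1), y i * (α' i * y i) = α' i * y i ^ 2 := fun i => by ring
  simp only [d1, d2]
  ring

lemma dotProduct_systemRHS (N M : ℕ) (α' α x y : ℕ → ℝ) :
    systemRHS N M α' α ⬝ᵥ pairVector N M x y
      = ∑ n ∈ Finset.range (N + 1), α n * x n + ∑ n ∈ Finset.range (M + 1), α' n * y n := by
  rw [systemRHS, pairVector, dotProduct, Fintype.sum_sum_type]
  simp [Finset.sum_range]

lemma sigma_pos {r R : ℝ} (hr : 0 < r) (hrR : r < R) (n : ℕ) : 0 < sigma r R n :=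
  pow_pos (div_pos hr (hr.trans hrR)) _

lemma systemMatrix_transpose (r R ρ : ℝ) (N M : ℕ) (α' α : ℕ → ℝ) (β : ℝ) :
    (systemMatrix r R ρ N M α' α β).transpose = systemMatrix r R ρ N M α' α β := by
  unfold systemMatrix
  rw [fromBlocks_transpose]
  congr 1 <;> ext i j <;>
    simp [gram_symm ρ (j : ℕ) (i : ℕ), Matrix.diagonal_apply, eq_comm]
  all_goals
    split_ifs with h
    · rw [h]
    · rfl

/-- The Gram part is the squared norm of the kernel with symbols `y - x`, hence nonnegative. A
nonzero entry of `v`, in either block, meets a positive diagonal weight. -/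
lemma systemMatrix_pos (hY : IsSphericalHarmonics Y) {r R ρ : ℝ} (hr : 0 < r) (hrR : r < R)
    (hρ : 0 ≤ ρ) (hρ2 : ρ ≤ 2) {N M : ℕ} (hNM : N ≤ M) {α' α : ℕ → ℝ} {β : ℝ}
    (hα' : ∀ n, n ≤ M → 0 < α' n) (hα : ∀ n, n ≤ N → 0 < α n) (hβ : 0 < β)
    (v : Fin (N + 1) ⊕ Fin (M + 1) → ℝ) (hv : v ≠ 0) :
    0 < v ⬝ᵥ systemMatrix r R ρ N M α' α β *ᵥ v := by
  obtain ⟨x, y, hx, rfl⟩ := exists_pairVector_eq v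
  rw [dotProduct_systemMatrix_mulVec hNM α' α β hx y,
    ← zonalNorm_kernelOf_sq hY hr hρ hρ2 M fun n => y n - x n]
  have hc : ∀ n, n ≤ N → 0 < β / sigma r R n ^ 2 + α n := fun n hn =>
    add_pos (div_pos hβ (pow_pos (sigma_pos hr hrR n) 2)) (hα n hn)
  have p1 : ∀ n ∈ Finset.range (N + 1), 0 ≤ (β / sigma r R n ^ 2 + α n) * x n ^ 2 := fun n hn =>
    mul_nonneg (hc n (Nat.lt_succ_iff.1 (Finset.mem_range.1 hn))).le (sq_nonneg _)
  have p2 : ∀ n ∈ Finset.range (M + 1), 0 ≤ α' n * y n ^ 2 := fun n hn =>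
    mul_nonneg (hα' n (Nat.lt_succ_iff.1 (Finset.mem_range.1 hn))).le (sq_nonneg _)
  have p3 : 0 ≤ 8 * Real.pi ^ 2 * r ^ 4 * zonalNorm ρ (kernelOf Y r r M fun n => y n - x n) ^ 2 := by
    positivity
  obtain ⟨i, hi⟩ := Function.ne_iff.1 hv
  rcases i with i | i
  · have hi' : x i ≠ 0 := hi
    have q : 0 < ∑ n ∈ Finset.range (N + 1), (β / sigma r R n ^ 2 + α n) * x n ^ 2 :=
      Finset.sum_pos' p1 ⟨i, Finset.mem_range.2 i.2,
        mul_pos (hc i (Nat.lt_succ_iff.1 i.2)) (by positivity)⟩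
    have := Finset.sum_nonneg p2
    linarith
  · have hi' : y i ≠ 0 := hi
    have q : 0 < ∑ n ∈ Finset.range (M + 1), α' n * y n ^ 2 :=
      Finset.sum_pos' p2 ⟨i, Finset.mem_range.2 i.2,
        mul_pos (hα' i (Nat.lt_succ_iff.1 i.2)) (by positivity)⟩
    have := Finset.sum_nonneg p1
    linarith

/-- The functional as a quadratic polynomial in the vector of symbols. -/
lemma functional_eq (hY : IsSphericalHarmonics Y) {r R ρ : ℝ} (hr : 0 < r) (hrR : r < R)
    (hρ : 0 ≤ ρ) (hρ2 : ρ ≤ 2) {N M : ℕ} (hNM : N ≤ M) (α' α : ℕ → ℝ) (β : ℝ)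
    {Φ : Kernel r R} {Ψ : Kernel r r} (hΦ : Φ ∈ Pol Y r R N) (hΨ : Ψ ∈ Pol Y r r M) :
    functional Y r R ρ N M α' α β Φ Ψ
      = (symbolVector Y r R N M Φ Ψ ⬝ᵥ
            systemMatrix r R ρ N M α' α β *ᵥ symbolVector Y r R N M Φ Ψ
          - 2 * (systemRHS N M α' α ⬝ᵥ symbolVector Y r R N M Φ Ψ))
        + (∑ n ∈ Finset.range (M + 1), α' n + ∑ n ∈ Finset.range (N + 1), α n) := by
  have hx : ∀ n, N < n → symbol Y r R N Φ n * sigma r R n = 0 := fun n hn => by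
    rw [(hasSymbol_symbol hΦ).1 n hn, zero_mul]
  have hvec : symbolVector Y r R N M Φ Ψ = pairVector N M
      (fun n => symbol Y r R N Φ n * sigma r R n) (auxSymbol Y r R N M Φ Ψ) := rfl
  rw [hvec, dotProduct_systemMatrix_mulVec hNM α' α β hx, dotProduct_systemRHS]
  have hz := zonalNorm_kernelOf_sq hY hr hρ hρ2 M (symbol Y r r M Ψ)
  rw [← (hasSymbol_symbol hΨ).2] at hz
  have hs : ∀ n, auxSymbol Y r R N M Φ Ψ n - symbol Y r R N Φ n * sigma r R n
      = symbol Y r r M Ψ n := fun n => by rw [auxSymbol]; ring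
  simp only [hs]
  rw [← hz, functional]
  simp only [sq_abs]
  -- The unknown is `Φ^∧(n) σ_n`, so the penalty `β |Φ^∧(n)|²` becomes the diagonal entry `β /
  -- σ_n²`.
  have e1 : ∀ n, (β / sigma r R n ^ 2 + α n) * (symbol Y r R N Φ n * sigma r R n) ^ 2
      = β * symbol Y r R N Φ n ^ 2 + α n * (symbol Y r R N Φ n * sigma r R n) ^ 2 := fun n => by
    have := (sigma_pos hr hrR n).ne'
    field_simp
  have e2 : ∀ c z : ℝ, c * (1 - z) ^ 2 = c * z ^ 2 - 2 * (c * z) + c := fun c z => by ring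
  simp only [e1, e2, Finset.sum_add_distrib, Finset.sum_sub_distrib, ← Finset.mul_sum]
  ring

/-- The substitution is undone: `Φ` gets the symbols `x / σ` and `Ψ` gets `y - x`. -/
lemma exists_symbolVector_eq (hY : IsSphericalHarmonics Y) {r R : ℝ} (hr : 0 < r) (hrR : r < R)
    {N M : ℕ} (v : Fin (N + 1) ⊕ Fin (M + 1) → ℝ) :
    ∃ Φ ∈ Pol Y r R N, ∃ Ψ ∈ Pol Y r r M, symbolVector Y r R N M Φ Ψ = v := by
  obtain ⟨x, y, hx, rfl⟩ := exists_pairVector_eq v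
  have hΦ : ∀ n, symbol Y r R N (kernelOf Y r R N fun n => x n / sigma r R n) n * sigma r R n
      = x n := by
    intro n
    by_cases hn : n ≤ N
    · rw [symbol_kernelOf hY hr (hr.trans hrR) _ hn,
        div_mul_cancel₀ _ (sigma_pos hr hrR n).ne']
    · rw [(hasSymbol_symbol ⟨_, rfl⟩).1 n (not_le.1 hn), hx n (not_le.1 hn), zero_mul]
  refine ⟨kernelOf Y r R N fun n => x n / sigma r R n, ⟨_, rfl⟩,
    kernelOf Y r r M fun n => y n - x n, ⟨_, rfl⟩, ?_⟩
  ext i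
  rcases i with i | i
  · exact hΦ i
  · change auxSymbol Y r R N M _ _ (i : ℕ) = y i
    rw [auxSymbol, hΦ, symbol_kernelOf hY hr hr _ (Nat.lt_succ_iff.1 i.2)]
    ring

lemma symbolVector_injective {r R : ℝ} (hr : 0 < r) (hrR : r < R) {N M : ℕ}
    {Φ Φ₁ : Kernel r R} {Ψ Ψ₁ : Kernel r r} (hΦ : Φ ∈ Pol Y r R N) (hΨ : Ψ ∈ Pol Y r r M)
    (hΦ₁ : Φ₁ ∈ Pol Y r R N) (hΨ₁ : Ψ₁ ∈ Pol Y r r M)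
    (h : symbolVector Y r R N M Φ Ψ = symbolVector Y r R N M Φ₁ Ψ₁) : Φ = Φ₁ ∧ Ψ = Ψ₁ := by
  have h1 : ∀ n, symbol Y r R N Φ n = symbol Y r R N Φ₁ n := by
    intro n
    by_cases hn : n ≤ N
    · have := congrFun h (Sum.inl ⟨n, Nat.lt_succ_of_le hn⟩)
      exact mul_right_cancel₀ (sigma_pos hr hrR n).ne' this
    · rw [(hasSymbol_symbol hΦ).1 n (not_le.1 hn), (hasSymbol_symbol hΦ₁).1 n (not_le.1 hn)]
  constructor
  · rw [(hasSymbol_symbol hΦ).2, (hasSymbol_symbol hΦ₁).2, kernelOf_congr fun n _ => h1 n]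
  · rw [(hasSymbol_symbol hΨ).2, (hasSymbol_symbol hΨ₁).2, kernelOf_congr fun n hn => ?_]
    have : auxSymbol Y r R N M Φ Ψ n = auxSymbol Y r R N M Φ₁ Ψ₁ n :=
      congrFun h (Sum.inr ⟨n, Nat.lt_succ_of_le hn⟩)
    rw [auxSymbol, auxSymbol, h1] at this
    exact add_right_cancel this

/-- Since every vector is a symbol vector, minimizing over kernels is the unconstrained problem of
`quadratic_minimizer_iff`. -/
lemma isMinimizer_iff (hY : IsSphericalHarmonics Y) {r R ρ : ℝ} (hr : 0 < r) (hrR : r < R)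
    (hρ : 0 ≤ ρ) (hρ2 : ρ ≤ 2) {N M : ℕ} (hNM : N ≤ M) {α' α : ℕ → ℝ} {β : ℝ}
    (hα' : ∀ n, n ≤ M → 0 < α' n) (hα : ∀ n, n ≤ N → 0 < α n) (hβ : 0 < β)
    {Φ : Kernel r R} {Ψ : Kernel r r} (hΦ : Φ ∈ Pol Y r R N) (hΨ : Ψ ∈ Pol Y r r M) :
    IsMinimizer Y r R ρ N M α' α β Φ Ψ ↔
      systemMatrix r R ρ N M α' α β *ᵥ symbolVector Y r R N M Φ Ψ = systemRHS N M α' α := by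
  rw [← quadratic_minimizer_iff (systemMatrix_transpose r R ρ N M α' α β)
    (systemMatrix_pos hY hr hrR hρ hρ2 hNM hα' hα hβ)]
  constructor
  · rintro ⟨-, -, h⟩ w
    obtain ⟨Φ₁, hΦ₁, Ψ₁, hΨ₁, rfl⟩ := exists_symbolVector_eq hY hr hrR w
    have := h Φ₁ hΦ₁ Ψ₁ hΨ₁
    rw [functional_eq hY hr hrR hρ hρ2 hNM α' α β hΦ hΨ,
      functional_eq hY hr hrR hρ hρ2 hNM α' α β hΦ₁ hΨ₁] at this
    exact le_of_add_le_add_right this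
  · intro h
    refine ⟨hΦ, hΨ, fun Φ₁ hΦ₁ Ψ₁ hΨ₁ => ?_⟩
    rw [functional_eq hY hr hrR hρ hρ2 hNM α' α β hΦ hΨ,
      functional_eq hY hr hrR hρ hρ2 hNM α' α β hΦ₁ hΨ₁]
    exact add_le_add_left (h _) _

end System

end

end TensorZonal

end

theorem lemma6p1
    (Y : (n : ℕ) → Fin (2 * n + 1) → MvPolynomial (Fin 3) ℝ)
    (hY : TensorZonal.IsSphericalHarmonics Y)
    (r R ρ κ : ℝ) (hr : 0 < r) (hrR : r < R) (hρ : 0 < ρ) (hρ2 : ρ < 2) (hκ : 1 < κ)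
    (N : ℕ) (α' α : ℕ → ℝ) (β : ℝ)
    (hα' : ∀ n, n ≤ ⌊κ * (N : ℝ)⌋₊ → 0 < α' n) (hα : ∀ n, n ≤ N → 0 < α n) (hβ : 0 < β) :
    (∃! p : TensorZonal.Kernel r R × TensorZonal.Kernel r r,
      TensorZonal.IsMinimizer Y r R ρ N ⌊κ * (N : ℝ)⌋₊ α' α β p.1 p.2) ∧
    (∀ Φ ∈ TensorZonal.Pol Y r R N, ∀ Ψ ∈ TensorZonal.Pol Y r r ⌊κ * (N : ℝ)⌋₊,
      (TensorZonal.IsMinimizer Y r R ρ N ⌊κ * (N : ℝ)⌋₊ α' α β Φ Ψ ↔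
        (TensorZonal.systemMatrix r R ρ N ⌊κ * (N : ℝ)⌋₊ α' α β).mulVec
            (TensorZonal.symbolVector Y r R N ⌊κ * (N : ℝ)⌋₊ Φ Ψ)
          = TensorZonal.systemRHS N ⌊κ * (N : ℝ)⌋₊ α' α)) ∧
    (∃! v : Fin (N + 1) ⊕ Fin (⌊κ * (N : ℝ)⌋₊ + 1) → ℝ,
      (TensorZonal.systemMatrix r R ρ N ⌊κ * (N : ℝ)⌋₊ α' α β).mulVec v
        = TensorZonal.systemRHS N ⌊κ * (N : ℝ)⌋₊ α' α) := by
  -- This makes the continuation of `x` by zero up to `M` meaningful; `κ > 1` enters here.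
  have hNM : N ≤ ⌊κ * (N : ℝ)⌋₊ :=
    Nat.le_floor (le_mul_of_one_le_left (Nat.cast_nonneg N) hκ.le)
  have hiff := fun {Φ Ψ} hΦ hΨ => TensorZonal.isMinimizer_iff hY hr hrR hρ.le hρ2.le hNM hα' hα hβ
    (Φ := Φ) (Ψ := Ψ) hΦ hΨ
  have hex := TensorZonal.existsUnique_mulVec_eq
    (TensorZonal.systemMatrix_pos hY hr hrR hρ.le hρ2.le hNM hα' hα hβ)
    (TensorZonal.systemRHS N ⌊κ * (N : ℝ)⌋₊ α' α)
  refine ⟨?_, fun Φ hΦ Ψ hΨ => hiff hΦ hΨ, hex⟩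
  obtain ⟨v, hv, huniq⟩ := hex
  obtain ⟨Φ, hΦ, Ψ, hΨ, rfl⟩ := TensorZonal.exists_symbolVector_eq hY hr hrR v
  refine ⟨(Φ, Ψ), (hiff hΦ hΨ).2 hv, ?_⟩
  rintro ⟨Φ₁, Ψ₁⟩ h
  obtain ⟨hΦ₁, hΨ₁⟩ : Φ₁ ∈ _ ∧ Ψ₁ ∈ _ := ⟨h.1, h.2.1⟩
  obtain ⟨e1, e2⟩ := TensorZonal.symbolVector_injective hr hrR hΦ₁ hΨ₁ hΦ hΨ
    (huniq _ ((hiff hΦ₁ hΨ₁).1 h))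
  exact Prod.ext e1 e2
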